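/- Let $K,\rho:\mathbb R\to(0,\infty)$ and $x_+>0$ be such that $(K,\rho)=(K_-,\rho_-)$ is constant for $x<0$, $(K,\rho)=(K_+,\rho_+)$ is constant for $x>x_+$, $K$ and $\rho$ are $C^1$ on $[0,x_+]$, and the impedance $Z(x)=\sqrt{K(x)\rho(x)}$ is continuous on $\mathbb R$. Put $c=\sqrt{K/\rho}$, $Z_-=\sqrt{K_-\rho_-}$, $c_-=\sqrt{K_- /\rho_-}$, $r=Z'/(2Z)$ (so $r=0$ outside $[0,x_+]$), $\tau(x)=\int_0^x dy/c(y)$ and $C_G(x)=\sqrt{Z(x)/Z_-}$. Let $p_0\in C^1(\mathbb R)$ with $p_0(x)=0$ for $x\ge 0$. Consider the initial value problem for $x\in\mathbb R$, $t\ge 0$: $$p_t+K(x)u_x=0,\qquad u_t+\frac1{\rho(x)}p_x=0,\qquad (p,u)(x,0)=\begin{cases}p_0(x)\,(1,1/Z_-) & x<0,\\ (0,0) & x\ge 0.\end{cases}$$ A solution is a pair $(p,u)$ of continuous functions on $\mathbb R\times[0,\infty)$ with these initial values such that, at every $(x,t)$ with $t>0$ and $K,\rho$ continuous at $x$ (hence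 at every $(x,t)$ with $t>0$ if $K,\rho$ are continuous), $p$ and $u$ are continuously differentiable in a neighbourhood of $(x,t)$ and satisfy the two equations. Call $\mathbf x=(x_1,\dots,x_n)\in[0,x_+]^n$ alternating if $x_2\le x_1$, $x_3\ge x_2$, $x_4\le x_3$, and so on; let $\mathcal P_n$ be the set of these sequences, and set $x_0=0$. Put $\hat\tau(\mathbf x)=2\sum_{j=1}^n(-1)^{j+1}\tau(x_j)$, $\xi_R(\mathbf x,x,t)=-c_-(t-\hat\tau(\mathbf x)+\tau(x))$ and $\xi_T(\mathbf x,x,t)=-c_-(t-\hat\tau(\mathbf x)-\tau(x))$. For $m\ge0$ let $$w^1_{2m+1}(x,t)=(-1)^mC_G(x)\int_{\mathcal P_{2m}}\prod_{j=1}^{2m}r(x_j)\int_{\max(x,x_{2m})}^{x_+}p_0(\xi_R(\mathbf x,x,t))\,r(x_{2m+1})\,dx_{2m+1}\,dx_1\cdots dx_{2m},$$ let $w^2_0(x,t)=C_G(x)\,p_0(-c_-(t-\tau(x)))$, and for $m\ge1$ let $$w^2_{2m}(x,t)=(-1)^mC_G(x)\int_{\mathcal P_{2m-1}}\prod_{j=1}^{2m-1}r(x_j)\int_0^{\min(x,x_{2m-1})}p_0(\xi_T(\mathbf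 x,x,t))\,r(x_{2m})\,dx_{2m}\,dx_1\cdots dx_{2m-1}.$$ Theorem. For every $x\in\mathbb R$ and every finite $t\ge0$ all these integrals exist and the series $\overline w^1(x,t)=\sum_{m\ge0}w^1_{2m+1}(x,t)$ and $\overline w^2(x,t)=\sum_{m\ge0}w^2_{2m}(x,t)$ converge absolutely. The function $\overline p=\overline w^1+\overline w^2$ is the pressure of the solution of the initial value problem: the pair $(\overline p,\overline u)$ with $\overline u=(\overline w^2-\overline w^1)/Z$ is a solution, and every solution $(p,u)$ equals $(\overline p,\overline u)$ on $\mathbb R\times[0,\infty)$. -/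

import Mathlib

open Set MeasureTheory Filter Topology

noncomputable section

/-- A one-dimensional acoustic medium with bulk modulus `K` and density `ρ` (both positive), which
is constant for `x < 0` (values `Kminus`, `ρminus`) and constant for `x > xplus` (values `Kplus`,
`ρplus`), and whose impedance `Z = √(K ρ)` is continuous on the whole line. -/
structure AcousticMedium where
  K : ℝ → ℝ
  ρ : ℝ → ℝ
  Kminus : ℝ
  ρminus : ℝ
  Kplus : ℝ
  ρplus : ℝ
  xplus : ℝ
  xplus_pos : 0 < xplus
  K_pos : ∀ x, 0 < K x
  ρ_pos : ∀ x, 0 < ρ x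
  K_left : ∀ x, x < 0 → K x = Kminus
  ρ_left : ∀ x, x < 0 → ρ x = ρminus
  K_right : ∀ x, xplus < x → K x = Kplus
  ρ_right : ∀ x, xplus < x → ρ x = ρplus
  continuous_impedance : Continuous fun x => √(K x * ρ x)

/-- A finite sequence `x₁, …, xₙ` (stored with indices `0, …, n - 1`) is alternating (down-up) if
`x₂ ≤ x₁`, `x₃ ≥ x₂`, `x₄ ≤ x₃`, and so on. -/
def IsAlternating {n : ℕ} (x : Fin n → ℝ) : Prop :=
  ∀ (i : ℕ) (h : i + 1 < n),
    (Even i → x ⟨i + 1, h⟩ ≤ x ⟨i, Nat.lt_of_succ_lt h⟩) ∧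
    (Odd i → x ⟨i, Nat.lt_of_succ_lt h⟩ ≤ x ⟨i + 1, h⟩)

/-- The alternating sequences of length `n` with entries in `[α, β]`. -/
def alternatingPaths (n : ℕ) (α β : ℝ) : Set (Fin n → ℝ) :=
  {x | (∀ i, x i ∈ Icc α β) ∧ IsAlternating x}

/-- The last entry `xₙ` of a sequence `x₁, …, xₙ`, with the convention `x₀ = 0` when `n = 0`. -/
def lastPoint : {n : ℕ} → (Fin n → ℝ) → ℝ
  | 0, _ => 0
  | n + 1, y => y (Fin.last n)

namespace AcousticMedium

/-- The impedance `Z(x) = √(K(x) ρ(x))`. -/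
def impedance (M : AcousticMedium) (x : ℝ) : ℝ := √(M.K x * M.ρ x)

/-- The sound speed `c(x) = √(K(x) / ρ(x))`. -/
def soundSpeed (M : AcousticMedium) (x : ℝ) : ℝ := √(M.K x / M.ρ x)

/-- The impedance `Z₋` of the left half-line. -/
def impedanceLeft (M : AcousticMedium) : ℝ := √(M.Kminus * M.ρminus)

/-- The sound speed `c₋` of the left half-line. -/
def soundSpeedLeft (M : AcousticMedium) : ℝ := √(M.Kminus / M.ρminus)

/-- The infinitesimal reflection coefficient `r(x) = Z'(x) / (2 Z(x))`. It vanishes outside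
`[0, xplus]`. Its values at the two points `0`, `xplus` do not affect the integrals below. -/
def reflCoeff (M : AcousticMedium) (x : ℝ) : ℝ := deriv M.impedance x / (2 * M.impedance x)

/-- The (signed) travel time `τ(x)` along a characteristic from `0` to `x`. -/
def travelTime (M : AcousticMedium) (x : ℝ) : ℝ := ∫ y in (0 : ℝ)..x, 1 / M.soundSpeed y

/-- Green's amplification factor `C_G(x) = √(Z(x) / Z₋)`. -/
def greenFactor (M : AcousticMedium) (x : ℝ) : ℝ := √(M.impedance x / M.impedanceLeft)

/-- `2 ∑ⱼ (-1)^(j+1) τ(xⱼ)`, the sum being over `j = 1, …, n`. -/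
def pathTime (M : AcousticMedium) {n : ℕ} (x : Fin n → ℝ) : ℝ :=
  2 * ∑ j : Fin n, (-1) ^ (j : ℕ) * M.travelTime (x j)

/-- Starting point `ξ_R` of the path with reflection points `y` that arrives, going to the left,
at `x` at time `t`. -/
def startR (M : AcousticMedium) {n : ℕ} (y : Fin n → ℝ) (x t : ℝ) : ℝ :=
  -M.soundSpeedLeft * (t - M.pathTime y + M.travelTime x)

/-- Starting point `ξ_T` of the path with reflection points `y` that arrives, going to the right,
at `x` at time `t`. -/
def startT (M : AcousticMedium) {n : ℕ} (y : Fin n → ℝ) (x t : ℝ) : ℝ :=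
  -M.soundSpeedLeft * (t - M.pathTime y - M.travelTime x)

/-- The innermost integrand of `w¹`, as a function of the last reflection point `s`, after the
earlier reflection points `y`. -/
def innerR (M : AcousticMedium) (p₀ : ℝ → ℝ) {n : ℕ} (x t : ℝ) (y : Fin n → ℝ) (s : ℝ) : ℝ :=
  p₀ (M.startR (Fin.snoc (α := fun _ => ℝ) y s) x t) * M.reflCoeff s

/-- The innermost integrand of `w²`. -/
def innerT (M : AcousticMedium) (p₀ : ℝ → ℝ) {n : ℕ} (x t : ℝ) (y : Fin n → ℝ) (s : ℝ) : ℝ :=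
  p₀ (M.startT (Fin.snoc (α := fun _ => ℝ) y s) x t) * M.reflCoeff s

/-- The outer integrand of `w¹`: the product of the first `n` reflection coefficients times the
integral over the last reflection point, from `max(x, xₙ)` to `xplus`. -/
def outerR (M : AcousticMedium) (p₀ : ℝ → ℝ) {n : ℕ} (x t : ℝ) (y : Fin n → ℝ) : ℝ :=
  (∏ j, M.reflCoeff (y j)) * ∫ s in (max x (lastPoint y))..M.xplus, M.innerR p₀ x t y s

/-- The outer integrand of `w²`: the product of the first `n` reflection coefficients times the
integral over the last reflection point, from `0` to `min(x, xₙ)`. -/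
def outerT (M : AcousticMedium) (p₀ : ℝ → ℝ) {n : ℕ} (x t : ℝ) (y : Fin n → ℝ) : ℝ :=
  (∏ j, M.reflCoeff (y j)) * ∫ s in (0 : ℝ)..(min x (lastPoint y)), M.innerT p₀ x t y s

/-- `M.wOne p₀ m x t` is `w¹_{2m+1}(x, t)`, the contribution of the left-going paths with `2m + 1`
reflection points. -/
def wOne (M : AcousticMedium) (p₀ : ℝ → ℝ) (m : ℕ) (x t : ℝ) : ℝ :=
  (-1) ^ m * M.greenFactor x *
    ∫ y in alternatingPaths (2 * m) 0 M.xplus, M.outerR p₀ x t y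

/-- `M.wTwo p₀ m x t` is `w²_{2m}(x, t)`, the contribution of the right-going paths with `2m`
reflection points. For `m = 0` there is nothing to integrate over. -/
def wTwo (M : AcousticMedium) (p₀ : ℝ → ℝ) (m : ℕ) (x t : ℝ) : ℝ :=
  match m with
  | 0 => M.greenFactor x * p₀ (M.startT (Fin.elim0 : Fin 0 → ℝ) x t)
  | k + 1 => (-1) ^ (k + 1) * M.greenFactor x *
      ∫ y in alternatingPaths (2 * k + 1) 0 M.xplus, M.outerT p₀ x t y

/-- All (inner and outer) iterated integrals in the terms `w¹_{2m+1}(x,t)` and `w²_{2m}(x,t)` are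
integrals of integrable functions. -/
def TermsWellDefined (M : AcousticMedium) (p₀ : ℝ → ℝ) (x t : ℝ) : Prop :=
  (∀ m : ℕ,
    (∀ y ∈ alternatingPaths (2 * m) 0 M.xplus,
      IntervalIntegrable (M.innerR p₀ x t y) volume (max x (lastPoint y)) M.xplus) ∧
    IntegrableOn (M.outerR p₀ x t) (alternatingPaths (2 * m) 0 M.xplus)) ∧
  (∀ k : ℕ,
    (∀ y ∈ alternatingPaths (2 * k + 1) 0 M.xplus,
      IntervalIntegrable (M.innerT p₀ x t y) volume 0 (min x (lastPoint y))) ∧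
    IntegrableOn (M.outerT p₀ x t) (alternatingPaths (2 * k + 1) 0 M.xplus))

/-- The path-sum pressure `p̄ = ∑ₘ w¹_{2m+1} + ∑ₘ w²_{2m}`. -/
def pBar (M : AcousticMedium) (p₀ : ℝ → ℝ) (x t : ℝ) : ℝ :=
  (∑' m, M.wOne p₀ m x t) + ∑' m, M.wTwo p₀ m x t

/-- The velocity that belongs to `p̄`: since `(p, u) = V (w¹, w²)` with
`V = [[1, 1], [-1/Z, 1/Z]]`, it is `(∑ₘ w²_{2m} - ∑ₘ w¹_{2m+1}) / Z`. -/
def uBar (M : AcousticMedium) (p₀ : ℝ → ℝ) (x t : ℝ) : ℝ :=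
  ((∑' m, M.wTwo p₀ m x t) - ∑' m, M.wOne p₀ m x t) / M.impedance x

/-- `(p, u)` solves, for `x ∈ ℝ` and `t ≥ 0`, the initial value problem
`p_t + K u_x = 0`, `u_t + p_x / ρ = 0` with right-going initial data
`(p, u)(x, 0) = p₀(x) (1, 1/Z₋)` for `x < 0` and `(p, u)(x, 0) = 0` for `x ≥ 0`.
Both functions are continuous up to `t = 0`; for `t > 0` they are continuously differentiable and
satisfy the equations at every `x` at which the coefficients `K`, `ρ` are continuous
(everywhere, if `K` and `ρ` are continuous). -/
structure IsSolution (M : AcousticMedium) (p₀ : ℝ → ℝ) (p u : ℝ → ℝ → ℝ) : Prop where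
  continuousOn_p : ContinuousOn (fun z : ℝ × ℝ => p z.1 z.2) (univ ×ˢ Ici 0)
  continuousOn_u : ContinuousOn (fun z : ℝ × ℝ => u z.1 z.2) (univ ×ˢ Ici 0)
  initial_neg : ∀ x, x < 0 → p x 0 = p₀ x ∧ u x 0 = p₀ x / M.impedanceLeft
  initial_nonneg : ∀ x, 0 ≤ x → p x 0 = 0 ∧ u x 0 = 0
  contDiffAt : ∀ x t, 0 < t → ContinuousAt M.K x → ContinuousAt M.ρ x →
    ContDiffAt ℝ 1 (fun z : ℝ × ℝ => p z.1 z.2) (x, t) ∧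
    ContDiffAt ℝ 1 (fun z : ℝ × ℝ => u z.1 z.2) (x, t)
  pressure_eq : ∀ x t, 0 < t → ContinuousAt M.K x → ContinuousAt M.ρ x →
    deriv (fun s => p x s) t + M.K x * deriv (fun y => u y t) x = 0
  velocity_eq : ∀ x t, 0 < t → ContinuousAt M.K x → ContinuousAt M.ρ x →
    deriv (fun s => u x s) t + 1 / M.ρ x * deriv (fun y => p y t) x = 0

end AcousticMedium

end

/-!
In the variables `p = C_G (v₁ + v₂)`, `Z u = C_G (v₂ - v₁)`, which differ from the Riemann
invariants by Green's factor, the acoustic system becomes `∂ₜv₁ - c ∂ₓv₁ = c r v₂`,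
`∂ₜv₂ + c ∂ₓv₂ = -c r v₁`. Integration along the characteristics turns the initial value problem
into the integral equations

* `v₁(x, t) = ∫ₓ^{x₊} r(s) v₂(s, t + τ(x) - τ(s)) ds`,
* `v₂(x, t) = q(t - τ(x)) - ∫₀ˣ r(s) v₁(s, t - τ(x) + τ(s)) ds`,

where `q(t) = p₀(-c₋ t)` is the signal that arrives at `x = 0`. Their Neumann series is the path
sum: its `n`-th term is the integral over all alternating sequences of `n` reflection points, which
follows by splitting off the last reflection point with Fubini's theorem
(`integral_outer_eq_pathIntegral`, `pathIntegral_succ`, `term_odd_eq_pathIntegral`).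

*Convergence.* The travel time between two points is at least a constant times their distance, so
that in the norm weighted with `exp (-rate * t)`, for a suitable rate, each integral operator has
norm at most `1 / 2` (`abs_leftOp_le`, `abs_rightOp_le`). As `q` vanishes for negative times, only
the bounded piece of `q` on `[0, T]` matters up to time `T`, and the series converges
geometrically, locally uniformly in time (`abs_term_succ_le`).

*The sum is a solution.* The operators commute with translations in time. Hence the time derivative
of the path sum for `q` is the path sum for `q'`, which is continuous. The spatial derivatives
follow from the integral equations away from the two interfaces, and then from the differential
equations, whose right-hand sides are continuous, at an interface where `K` and `ρ` happen to be
continuous (`hasDerivAt_space_of_ne`, `hasDerivAt_space`).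

*Uniqueness.* Any solution satisfies the integral equations down to the initial time; crossing an
interface is harmless because the invariants are continuous there. The difference of two solutions
satisfies the homogeneous equations, and the factor `1 / 2`, applied on a compact domain of
dependence, forces it to vanish (`eq_zero_of_homogeneous`).
-/

noncomputable section

/-! ### The integral operators along characteristics -/

/-- The data that enter the integral equations along the characteristics: the length of the
scattering region `[0, len]`, a continuous bounded reflection coefficient `refl`, and a continuous
travel time `time` whose slope is at least `slow > 0`. Outside `[0, len]` the values of `refl` are
irrelevant, as the operators below only integrate over `[0, len]`. -/
structure ScatteringData where
  len : ℝ
  len_pos : 0 < len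
  refl : ℝ → ℝ
  continuous_refl : Continuous refl
  bnd : ℝ
  bnd_pos : 0 < bnd
  abs_refl_le : ∀ s, |refl s| ≤ bnd
  time : ℝ → ℝ
  continuous_time : Continuous time
  time_zero : time 0 = 0
  slow : ℝ
  slow_pos : 0 < slow
  slow_mul_le : ∀ a b, a ≤ b → slow * (b - a) ≤ time b - time a

/-- The point of `[0, len]` nearest to `x`, for `len ≥ 0`. -/
def clampTo (len x : ℝ) : ℝ := max 0 (min x len)

theorem continuous_clampTo (len : ℝ) : Continuous (clampTo len) := by
  unfold clampTo; fun_prop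

theorem clampTo_mem {len : ℝ} (h : 0 < len) (x : ℝ) : clampTo len x ∈ Icc 0 len := by
  unfold clampTo; constructor
  · exact le_max_left _ _
  · exact max_le h.le (min_le_right _ _)

theorem clampTo_of_mem {len x : ℝ} (h : x ∈ Icc 0 len) : clampTo len x = x := by
  unfold clampTo; rw [min_eq_left h.2, max_eq_right h.1]

theorem clampTo_of_nonpos {len x : ℝ} (hx : x ≤ 0) : clampTo len x = 0 := by
  unfold clampTo; rw [max_eq_left]; exact (min_le_left _ _).trans hx

theorem clampTo_of_le {len x : ℝ} (h : 0 < len) (hx : len ≤ x) : clampTo len x = len := by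
  unfold clampTo; rw [min_eq_right hx, max_eq_right h.le]

namespace ScatteringData

variable (D : ScatteringData)

/-- Integration along the left-going characteristic that ends at `(x, t)`. -/
def leftOp (f : ℝ → ℝ → ℝ) (x t : ℝ) : ℝ :=
  ∫ s in (clampTo D.len x)..D.len, D.refl s * f s (t + D.time x - D.time s)

/-- Integration along the right-going characteristic that ends at `(x, t)`. -/
def rightOp (f : ℝ → ℝ → ℝ) (x t : ℝ) : ℝ :=
  -∫ s in (0 : ℝ)..(clampTo D.len x), D.refl s * f s (t - D.time x + D.time s)

/-- The contribution of the paths with exactly `n` reflections, for the incoming signal `q`: the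
`n`-th term of the Neumann series of the integral equations, without Green's factor. After an odd
number of reflections a path goes to the left. -/
def term (q : ℝ → ℝ) : ℕ → ℝ → ℝ → ℝ
  | 0 => fun x t => q (t - D.time x)
  | n + 1 => if Even n then D.leftOp (term q n) else D.rightOp (term q n)

theorem term_odd (q : ℝ → ℝ) (m : ℕ) : D.term q (2 * m + 1) = D.leftOp (D.term q (2 * m)) := by
  simp [term]

theorem term_even (q : ℝ → ℝ) (m : ℕ) :
    D.term q (2 * m + 2) = D.rightOp (D.term q (2 * m + 1)) := by
  have : ¬ Even (2 * m + 1) := by simp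
  rw [term, if_neg this]

theorem monotone_time : Monotone D.time := fun a b h => by
  have := D.slow_mul_le a b h
  have := mul_nonneg D.slow_pos.le (sub_nonneg.2 h)
  linarith

/-! ### Exponential bounds -/

/-- The exponential growth rate in time for which the operators along the characteristics have
norm at most `1 / 2`. -/
def rate : ℝ := 2 * D.bnd / D.slow

theorem rate_pos : 0 < D.rate := div_pos (mul_pos two_pos D.bnd_pos) D.slow_pos

theorem rate_mul_slow : D.rate * D.slow = 2 * D.bnd := by
  unfold rate; field_simp [D.slow_pos.ne']

/-- The basic estimate: if an integrand decays exponentially away from the endpoint `b`, at the rate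
that the travel time enforces, then integration gains a factor `1 / 2`. -/
theorem abs_integral_le_of_exp_right {g : ℝ → ℝ} {a b B t : ℝ} (hab : a ≤ b) (hB : 0 ≤ B)
    (hg : ∀ s ∈ Icc a b, |g s| ≤ D.bnd * (B * Real.exp (D.rate * (t - D.slow * (b - s))))) :
    |∫ s in a..b, g s| ≤ B / 2 * Real.exp (D.rate * t) := by
  have hd : ∀ s ∈ uIcc a b,
      HasDerivAt (fun s => B / 2 * Real.exp (D.rate * (t - D.slow * (b - s))))
        (D.bnd * (B * Real.exp (D.rate * (t - D.slow * (b - s))))) s := by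
    intro s _
    have h1 : HasDerivAt (fun s : ℝ => D.rate * (t - D.slow * (b - s))) (D.rate * D.slow) s := by
      have := ((((hasDerivAt_id s).const_sub b).const_mul D.slow).const_sub t).const_mul D.rate
      simpa using this
    have h2 := (h1.exp).const_mul (B / 2)
    refine h2.congr_deriv ?_
    rw [D.rate_mul_slow]; ring
  have hint : IntervalIntegrable
      (fun s => D.bnd * (B * Real.exp (D.rate * (t - D.slow * (b - s))))) volume a b :=
    Continuous.intervalIntegrable (by fun_prop) _ _
  have h := intervalIntegral.norm_integral_le_of_norm_le (f := g) hab
    (Eventually.of_forall fun s hs => hg s (Ioc_subset_Icc_self hs)) hint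
  rw [intervalIntegral.integral_eq_sub_of_hasDerivAt hd hint] at h
  refine h.trans ?_
  have : 0 ≤ B / 2 * Real.exp (D.rate * (t - D.slow * (b - a))) := by positivity
  simp only [sub_self, mul_zero, sub_zero]
  linarith

theorem abs_integral_le_of_exp_left {g : ℝ → ℝ} {a b B t : ℝ} (hab : a ≤ b) (hB : 0 ≤ B)
    (hg : ∀ s ∈ Icc a b, |g s| ≤ D.bnd * (B * Real.exp (D.rate * (t - D.slow * (s - a))))) :
    |∫ s in a..b, g s| ≤ B / 2 * Real.exp (D.rate * t) := by
  have h := D.abs_integral_le_of_exp_right (g := fun s => g (-s)) (a := -b) (b := -a) (t := t)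
    (neg_le_neg hab) hB (fun s hs => by
      have := hg (-s) ⟨by linarith [hs.2], by linarith [hs.1]⟩
      rwa [show -s - a = -a - s by ring] at this)
  simpa [intervalIntegral.integral_comp_neg] using h

theorem abs_refl_mul_le {s y B t T : ℝ} (hB : 0 ≤ B) (hy : |y| ≤ B * Real.exp (D.rate * t))
    (ht : t ≤ T) : |D.refl s * y| ≤ D.bnd * (B * Real.exp (D.rate * T)) := by
  rw [abs_mul]
  refine mul_le_mul (D.abs_refl_le s) (hy.trans ?_) (abs_nonneg _) D.bnd_pos.le
  have := D.rate_pos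
  gcongr

theorem abs_leftOp_le {f : ℝ → ℝ → ℝ} {B T : ℝ} (hB : 0 ≤ B)
    (hf : ∀ s ∈ Icc 0 D.len, ∀ t ≤ T, |f s t| ≤ B * Real.exp (D.rate * t)) (x t : ℝ)
    (ht : t ≤ T) : |D.leftOp f x t| ≤ B / 2 * Real.exp (D.rate * t) := by
  unfold leftOp
  rcases le_or_gt D.len x with hx | hx
  -- No left-going path arrives from beyond the medium.
  · rw [clampTo_of_le D.len_pos hx, intervalIntegral.integral_same, abs_zero]
    positivity
  · have hc := clampTo_mem D.len_pos x
    refine D.abs_integral_le_of_exp_left hc.2 hB fun s hs => ?_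
    have hxc : x ≤ clampTo D.len x := by
      unfold clampTo; rw [min_eq_left hx.le]; exact le_max_right _ _
    have h1 := D.slow_mul_le x s (hxc.trans hs.1)
    have h2 : D.slow * (s - clampTo D.len x) ≤ D.slow * (s - x) :=
      mul_le_mul_of_nonneg_left (by linarith) D.slow_pos.le
    have h3 : 0 ≤ D.slow * (s - clampTo D.len x) :=
      mul_nonneg D.slow_pos.le (by linarith [hs.1])
    exact D.abs_refl_mul_le hB (hf s ⟨hc.1.trans hs.1, hs.2⟩ _ (by linarith)) (by linarith)

theorem abs_rightOp_le {f : ℝ → ℝ → ℝ} {B T : ℝ} (hB : 0 ≤ B)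
    (hf : ∀ s ∈ Icc 0 D.len, ∀ t ≤ T, |f s t| ≤ B * Real.exp (D.rate * t)) (x t : ℝ)
    (ht : t ≤ T) : |D.rightOp f x t| ≤ B / 2 * Real.exp (D.rate * t) := by
  unfold rightOp
  rw [abs_neg]
  rcases le_or_gt x 0 with hx | hx
  · rw [clampTo_of_nonpos hx, intervalIntegral.integral_same, abs_zero]
    positivity
  · have hc := clampTo_mem D.len_pos x
    refine D.abs_integral_le_of_exp_right hc.1 hB fun s hs => ?_
    have hxc : clampTo D.len x ≤ x := by
      unfold clampTo; exact max_le hx.le (min_le_left _ _)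
    have h1 := D.slow_mul_le s x (hs.2.trans hxc)
    have h2 : D.slow * (clampTo D.len x - s) ≤ D.slow * (x - s) :=
      mul_le_mul_of_nonneg_left (by linarith) D.slow_pos.le
    have h3 : 0 ≤ D.slow * (clampTo D.len x - s) :=
      mul_nonneg D.slow_pos.le (by linarith [hs.2])
    exact D.abs_refl_mul_le hB (hf s ⟨hs.1, hs.2.trans hc.2⟩ _ (by linarith)) (by linarith)

/-- The signal has to travel to the place of observation, so that inside the medium only its
values at times in `[0, T]` matter up to time `T`. -/
theorem abs_term_zero_le {q : ℝ → ℝ} {B T : ℝ} (hq : ∀ t ≤ 0, q t = 0) (hB : 0 ≤ B)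
    (hqB : ∀ t ≤ T, |q t| ≤ B) {x t : ℝ} (hx : 0 ≤ x) (ht : t ≤ T) :
    |D.term q 0 x t| ≤ B * Real.exp (D.rate * t) := by
  have hx' : 0 ≤ D.time x := by have := D.monotone_time hx; rwa [D.time_zero] at this
  simp only [term]
  rcases le_or_gt t 0 with h0 | h0
  · rw [hq _ (by linarith), abs_zero]; positivity
  · refine (hqB _ (by linarith)).trans (le_mul_of_one_le_right hB ?_)
    exact Real.one_le_exp (mul_nonneg D.rate_pos.le h0.le)

theorem abs_term_succ_le {q : ℝ → ℝ} {B T : ℝ} (hq : ∀ t ≤ 0, q t = 0) (hB : 0 ≤ B)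
    (hqB : ∀ t ≤ T, |q t| ≤ B) (n : ℕ) (x t : ℝ) (ht : t ≤ T) :
    |D.term q (n + 1) x t| ≤ B / 2 ^ (n + 1) * Real.exp (D.rate * t) := by
  induction n generalizing x t with
  | zero =>
    have := D.abs_leftOp_le (f := D.term q 0) hB
      (fun s hs t ht => D.abs_term_zero_le hq hB hqB hs.1 ht) x t ht
    simpa [term] using this
  | succ n ih =>
    have hB' : 0 ≤ B / 2 ^ (n + 1) := by positivity
    rw [show B / 2 ^ (n + 1 + 1) = B / 2 ^ (n + 1) / 2 by rw [pow_succ]; ring]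
    rw [term]
    split_ifs
    · exact D.abs_leftOp_le hB' (fun s _ t ht => ih s t ht) x t ht
    · exact D.abs_rightOp_le hB' (fun s _ t ht => ih s t ht) x t ht

/-! ### Continuity and time derivatives of the terms -/

theorem continuous_leftOp {f : ℝ → ℝ → ℝ} (hf : Continuous fun z : ℝ × ℝ => f z.1 z.2) :
    Continuous fun z : ℝ × ℝ => D.leftOp f z.1 z.2 := by
  have hR := D.continuous_refl
  have hτ := D.continuous_time
  have hc := continuous_clampTo D.len
  unfold leftOp
  simp_rw [intervalIntegral.integral_symm D.len]
  refine (intervalIntegral.continuous_parametric_intervalIntegral_of_continuous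
    (f := fun (z : ℝ × ℝ) s => D.refl s * f s (z.2 + D.time z.1 - D.time s)) ?_
    (hc.comp continuous_fst)).neg
  have : Continuous fun w : (ℝ × ℝ) × ℝ =>
      f w.2 (w.1.2 + D.time w.1.1 - D.time w.2) :=
    hf.comp (g := fun z : ℝ × ℝ => f z.1 z.2)
      (f := fun w : (ℝ × ℝ) × ℝ => (w.2, w.1.2 + D.time w.1.1 - D.time w.2)) (by fun_prop)
  exact (hR.comp continuous_snd).mul this

theorem continuous_rightOp {f : ℝ → ℝ → ℝ} (hf : Continuous fun z : ℝ × ℝ => f z.1 z.2) :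
    Continuous fun z : ℝ × ℝ => D.rightOp f z.1 z.2 := by
  have hR := D.continuous_refl
  have hτ := D.continuous_time
  have hc := continuous_clampTo D.len
  unfold rightOp
  refine (intervalIntegral.continuous_parametric_intervalIntegral_of_continuous
    (f := fun (z : ℝ × ℝ) s => D.refl s * f s (z.2 - D.time z.1 + D.time s)) ?_
    (hc.comp continuous_fst)).neg
  have : Continuous fun w : (ℝ × ℝ) × ℝ =>
      f w.2 (w.1.2 - D.time w.1.1 + D.time w.2) :=
    hf.comp (g := fun z : ℝ × ℝ => f z.1 z.2)
      (f := fun w : (ℝ × ℝ) × ℝ => (w.2, w.1.2 - D.time w.1.1 + D.time w.2)) (by fun_prop)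
  exact (hR.comp continuous_snd).mul this

theorem continuous_term {q : ℝ → ℝ} (hq : Continuous q) (n : ℕ) :
    Continuous fun z : ℝ × ℝ => D.term q n z.1 z.2 := by
  induction n with
  | zero =>
    have hτ := D.continuous_time
    simp only [term]; fun_prop
  | succ n ih =>
    rw [term]
    split_ifs
    · exact D.continuous_leftOp ih
    · exact D.continuous_rightOp ih

end ScatteringData

/-- Differentiation under the integral sign, for a jointly continuous derivative. -/
theorem hasDerivAt_intervalIntegral_of_continuous {F F' : ℝ → ℝ → ℝ} {a b : ℝ}
    (hF : Continuous fun z : ℝ × ℝ => F z.1 z.2) (hF' : Continuous fun z : ℝ × ℝ => F' z.1 z.2)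
    (hd : ∀ t s, HasDerivAt (fun t => F t s) (F' t s) t) (t : ℝ) :
    HasDerivAt (fun t => ∫ s in a..b, F t s) (∫ s in a..b, F' t s) t := by
  obtain ⟨C, hC⟩ := ((isCompact_closedBall t 1).prod
    (isCompact_uIcc (a := a) (b := b))).exists_bound_of_continuousOn hF'.continuousOn
  have hs : ∀ {G : ℝ → ℝ → ℝ}, Continuous (fun z : ℝ × ℝ => G z.1 z.2) → ∀ t, Continuous (G t) :=
    fun hG t => hG.comp (f := fun s : ℝ => (t, s)) (by fun_prop)
  refine (intervalIntegral.hasDerivAt_integral_of_dominated_loc_of_deriv_le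
    (bound := fun _ => C) (s := Metric.closedBall t 1) (Metric.closedBall_mem_nhds t one_pos)
    (Eventually.of_forall fun t => (hs hF t).aestronglyMeasurable)
    ((hs hF t).intervalIntegrable _ _) (hs hF' t).aestronglyMeasurable
    (Eventually.of_forall fun s hs t ht => hC (t, s) ⟨ht, uIoc_subset_uIcc hs⟩)
    intervalIntegrable_const
    (Eventually.of_forall fun s _ t _ => hd t s)).2

namespace ScatteringData

variable (D : ScatteringData)

theorem hasDerivAt_leftOp {f f' : ℝ → ℝ → ℝ} (hf : Continuous fun z : ℝ × ℝ => f z.1 z.2)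
    (hf' : Continuous fun z : ℝ × ℝ => f' z.1 z.2)
    (hd : ∀ x t, HasDerivAt (fun t => f x t) (f' x t) t) (x t : ℝ) :
    HasDerivAt (fun t => D.leftOp f x t) (D.leftOp f' x t) t := by
  have hR := D.continuous_refl
  have hτ := D.continuous_time
  have key : ∀ {g : ℝ → ℝ → ℝ}, (Continuous fun z : ℝ × ℝ => g z.1 z.2) →
      Continuous fun z : ℝ × ℝ => D.refl z.2 * g z.2 (z.1 + D.time x - D.time z.2) :=
    fun {g} hg => (hR.comp continuous_snd).mul (hg.comp (g := fun z : ℝ × ℝ => g z.1 z.2)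
      (f := fun z : ℝ × ℝ => (z.2, z.1 + D.time x - D.time z.2)) (by fun_prop))
  refine hasDerivAt_intervalIntegral_of_continuous
    (F := fun t s => D.refl s * f s (t + D.time x - D.time s))
    (F' := fun t s => D.refl s * f' s (t + D.time x - D.time s))
    (key hf) (key hf') (fun t s => ?_) t
  have h1 : HasDerivAt (fun t => t + D.time x - D.time s) 1 t :=
    ((hasDerivAt_id t).add_const _).sub_const _
  have := (HasDerivAt.comp t (hd s _) h1).const_mul (D.refl s)
  simpa using this

theorem hasDerivAt_rightOp {f f' : ℝ → ℝ → ℝ} (hf : Continuous fun z : ℝ × ℝ => f z.1 z.2)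
    (hf' : Continuous fun z : ℝ × ℝ => f' z.1 z.2)
    (hd : ∀ x t, HasDerivAt (fun t => f x t) (f' x t) t) (x t : ℝ) :
    HasDerivAt (fun t => D.rightOp f x t) (D.rightOp f' x t) t := by
  have hR := D.continuous_refl
  have hτ := D.continuous_time
  have key : ∀ {g : ℝ → ℝ → ℝ}, (Continuous fun z : ℝ × ℝ => g z.1 z.2) →
      Continuous fun z : ℝ × ℝ => D.refl z.2 * g z.2 (z.1 - D.time x + D.time z.2) :=
    fun {g} hg => (hR.comp continuous_snd).mul (hg.comp (g := fun z : ℝ × ℝ => g z.1 z.2)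
      (f := fun z : ℝ × ℝ => (z.2, z.1 - D.time x + D.time z.2)) (by fun_prop))
  refine (hasDerivAt_intervalIntegral_of_continuous
    (F := fun t s => D.refl s * f s (t - D.time x + D.time s))
    (F' := fun t s => D.refl s * f' s (t - D.time x + D.time s))
    (key hf) (key hf') (fun t s => ?_) t).neg
  have h1 : HasDerivAt (fun t => t - D.time x + D.time s) 1 t :=
    ((hasDerivAt_id t).sub_const _).add_const _
  have := (HasDerivAt.comp t (hd s _) h1).const_mul (D.refl s)
  simpa using this

theorem hasDerivAt_term {q q' : ℝ → ℝ} (hq' : Continuous q')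
    (hd : ∀ t, HasDerivAt q (q' t) t) (n : ℕ) (x t : ℝ) :
    HasDerivAt (fun t => D.term q n x t) (D.term q' n x t) t := by
  have hq : Continuous q := continuous_iff_continuousAt.2 fun t => (hd t).continuousAt
  induction n generalizing x t with
  | zero =>
    have h1 : HasDerivAt (fun t => t - D.time x) 1 t := (hasDerivAt_id t).sub_const _
    have := HasDerivAt.comp t (hd _) h1
    simpa [term] using! this
  | succ n ih =>
    rw [term, term]
    split_ifs
    · exact D.hasDerivAt_leftOp (D.continuous_term hq n) (D.continuous_term hq' n) ih x t
    · exact D.hasDerivAt_rightOp (D.continuous_term hq n) (D.continuous_term hq' n) ih x t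

end ScatteringData

/-- The chain rule for an integral whose lower limit and parameter both depend on `x`. -/
theorem hasDerivAt_intervalIntegral_comp {F F' : ℝ → ℝ → ℝ} {α β : ℝ → ℝ} {α' β' b x : ℝ}
    (hF : Continuous fun z : ℝ × ℝ => F z.1 z.2) (hF' : Continuous fun z : ℝ × ℝ => F' z.1 z.2)
    (hd : ∀ t s, HasDerivAt (fun t => F t s) (F' t s) t)
    (hα : HasDerivAt α α' x) (hβ : HasDerivAt β β' x) :
    HasDerivAt (fun x => ∫ s in (α x)..b, F (β x) s)
      (-(α' * F (β x) (α x)) + β' * ∫ s in (α x)..b, F' (β x) s) x := by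
  have hs : ∀ t, Continuous (F t) :=
    fun t => hF.comp (f := fun s : ℝ => (t, s)) (by fun_prop)
  have hsmul : Continuous fun c : ℝ => ContinuousLinearMap.toSpanSingleton ℝ c :=
    (ContinuousLinearMap.toSpanSingletonCLE (𝕜 := ℝ) (E := ℝ)).continuous
  have hstrict := hasStrictFDerivAt_uncurry_coprod (𝕜 := ℝ) (u := (α x, β x))
    (f := fun a t => ∫ s in a..b, F t s)
    (f₁ := fun a t => ContinuousLinearMap.toSpanSingleton ℝ (-F t a))
    (f₂ := fun a t => ContinuousLinearMap.toSpanSingleton ℝ (∫ s in a..b, F' t s))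
    (Eventually.of_forall fun v => by
      have := intervalIntegral.integral_hasDerivAt_left (f := F v.2) (a := v.1) (b := b)
        ((hs v.2).intervalIntegrable _ _)
        ((hs v.2).stronglyMeasurableAtFilter _ _) (hs v.2).continuousAt
      exact this.hasFDerivAt)
    (Eventually.of_forall fun v =>
      (hasDerivAt_intervalIntegral_of_continuous hF hF' hd v.2).hasFDerivAt)
    (by
      refine (hsmul.comp ?_).continuousAt
      exact (hF.comp (f := fun z : ℝ × ℝ => (z.2, z.1)) (by fun_prop)).neg)
    (by
      refine (hsmul.comp ?_).continuousAt
      change Continuous fun z : ℝ × ℝ => ∫ s in z.1..b, F' z.2 s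
      simp_rw [intervalIntegral.integral_symm b]
      exact (intervalIntegral.continuous_parametric_intervalIntegral_of_continuous
        (f := fun (z : ℝ × ℝ) s => F' z.2 s)
        (hF'.comp (f := fun w : (ℝ × ℝ) × ℝ => (w.1.2, w.2)) (by fun_prop))
        continuous_fst).neg)
  have := hstrict.hasFDerivAt.comp_hasDerivAt x (hα.prodMk hβ)
  refine this.congr_deriv ?_
  simp [Function.HasUncurry.uncurry]

namespace ScatteringData

variable (D : ScatteringData)

/-- The spatial derivative of `leftOp f`, at points where the travel time has slope `k` and the
projection to `[0, len]` has slope `e`; so `e = 1` inside and `e = 0` outside the medium. -/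
theorem hasDerivAt_leftOp_space {f f' : ℝ → ℝ → ℝ}
    (hf : Continuous fun z : ℝ × ℝ => f z.1 z.2)
    (hf' : Continuous fun z : ℝ × ℝ => f' z.1 z.2)
    (hd : ∀ x t, HasDerivAt (fun t => f x t) (f' x t) t) {x t k e : ℝ}
    (hτ : HasDerivAt D.time k x) (hc : HasDerivAt (clampTo D.len) e x) :
    HasDerivAt (fun x => D.leftOp f x t)
      (-(e * (D.refl (clampTo D.len x) *
        f (clampTo D.len x) (t + D.time x - D.time (clampTo D.len x)))) +
        k * D.leftOp f' x t) x := by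
  have hR := D.continuous_refl
  have hτc := D.continuous_time
  have key : ∀ {g : ℝ → ℝ → ℝ}, (Continuous fun z : ℝ × ℝ => g z.1 z.2) →
      Continuous fun z : ℝ × ℝ => D.refl z.2 * g z.2 (z.1 - D.time z.2) :=
    fun {g} hg => (hR.comp continuous_snd).mul (hg.comp (g := fun z : ℝ × ℝ => g z.1 z.2)
      (f := fun z : ℝ × ℝ => (z.2, z.1 - D.time z.2)) (by fun_prop))
  exact hasDerivAt_intervalIntegral_comp (F := fun θ s => D.refl s * f s (θ - D.time s))
    (F' := fun θ s => D.refl s * f' s (θ - D.time s)) (b := D.len)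
    (key hf) (key hf') (fun θ s => by
      have h1 : HasDerivAt (fun θ => θ - D.time s) 1 θ := (hasDerivAt_id θ).sub_const _
      simpa using (HasDerivAt.comp θ (hd s _) h1).const_mul (D.refl s)) hc (hτ.const_add t)

theorem hasDerivAt_rightOp_space {f f' : ℝ → ℝ → ℝ}
    (hf : Continuous fun z : ℝ × ℝ => f z.1 z.2)
    (hf' : Continuous fun z : ℝ × ℝ => f' z.1 z.2)
    (hd : ∀ x t, HasDerivAt (fun t => f x t) (f' x t) t) {x t k e : ℝ}
    (hτ : HasDerivAt D.time k x) (hc : HasDerivAt (clampTo D.len) e x) :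
    HasDerivAt (fun x => D.rightOp f x t)
      (-(e * (D.refl (clampTo D.len x) *
        f (clampTo D.len x) (t - D.time x + D.time (clampTo D.len x)))) -
        k * D.rightOp f' x t) x := by
  have hR := D.continuous_refl
  have hτc := D.continuous_time
  have key : ∀ {g : ℝ → ℝ → ℝ}, (Continuous fun z : ℝ × ℝ => g z.1 z.2) →
      Continuous fun z : ℝ × ℝ => D.refl z.2 * g z.2 (z.1 + D.time z.2) :=
    fun {g} hg => (hR.comp continuous_snd).mul (hg.comp (g := fun z : ℝ × ℝ => g z.1 z.2)
      (f := fun z : ℝ × ℝ => (z.2, z.1 + D.time z.2)) (by fun_prop))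
  have h := hasDerivAt_intervalIntegral_comp (F := fun θ s => D.refl s * f s (θ + D.time s))
    (F' := fun θ s => D.refl s * f' s (θ + D.time s)) (b := 0)
    (key hf) (key hf') (fun θ s => by
      have h1 : HasDerivAt (fun θ => θ + D.time s) 1 θ := (hasDerivAt_id θ).add_const _
      simpa using (HasDerivAt.comp θ (hd s _) h1).const_mul (D.refl s)) hc (hτ.const_sub t)
  unfold rightOp
  simp_rw [← intervalIntegral.integral_symm]
  refine h.congr_deriv ?_
  ring

/-! ### Summation over the number of reflections -/

/-- The terms of the sequence `f` decay geometrically, locally uniformly in time and uniformly in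
`x ∈ S`. -/
def GeometricDecay (S : Set ℝ) (f : ℕ → ℝ → ℝ → ℝ) : Prop :=
  ∀ T, ∃ B, 0 ≤ B ∧ ∀ n, ∀ x ∈ S, ∀ t ≤ T, |f n x t| ≤ B * (1 / 2) ^ n * Real.exp (D.rate * t)

variable {D}

theorem GeometricDecay.exists_bound {S : Set ℝ} {f : ℕ → ℝ → ℝ → ℝ} (h : D.GeometricDecay S f)
    (T : ℝ) : ∃ B, 0 ≤ B ∧ ∀ n, ∀ x ∈ S, ∀ t ≤ T, |f n x t| ≤ B * (1 / 2) ^ n := by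
  obtain ⟨B, hB, hf⟩ := h T
  refine ⟨B * Real.exp (D.rate * T), by positivity, fun n x hx t ht => (hf n x hx t ht).trans ?_⟩
  have := D.rate_pos
  calc B * (1 / 2) ^ n * Real.exp (D.rate * t) ≤ B * (1 / 2) ^ n * Real.exp (D.rate * T) := by
        gcongr
    _ = _ := by ring

theorem GeometricDecay.summable {S : Set ℝ} {f : ℕ → ℝ → ℝ → ℝ} (h : D.GeometricDecay S f)
    {x : ℝ} (hx : x ∈ S) (t : ℝ) : Summable fun n => f n x t := by
  obtain ⟨B, -, hf⟩ := h.exists_bound t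
  exact Summable.of_norm_bounded (summable_geometric_two.mul_left B)
    fun n => hf n x hx t le_rfl

theorem GeometricDecay.continuous_tsum {f : ℕ → ℝ → ℝ → ℝ} (h : D.GeometricDecay univ f)
    (hc : ∀ n, Continuous fun z : ℝ × ℝ => f n z.1 z.2) :
    Continuous fun z : ℝ × ℝ => ∑' n, f n z.1 z.2 := by
  rw [continuous_iff_continuousAt]
  intro z
  obtain ⟨B, -, hf⟩ := h.exists_bound (z.2 + 1)
  have := continuousOn_tsum (s := {w : ℝ × ℝ | w.2 < z.2 + 1}) (fun n => (hc n).continuousOn)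
    (summable_geometric_two.mul_left B)
    (fun n w hw => hf n w.1 (mem_univ _) w.2 (le_of_lt hw))
  exact this.continuousAt ((isOpen_lt continuous_snd continuous_const).mem_nhds (by simp))

theorem GeometricDecay.hasDerivAt_tsum {f f' : ℕ → ℝ → ℝ → ℝ} (h : D.GeometricDecay univ f)
    (h' : D.GeometricDecay univ f')
    (hd : ∀ n x t, HasDerivAt (fun t => f n x t) (f' n x t) t) (x t : ℝ) :
    HasDerivAt (fun t => ∑' n, f n x t) (∑' n, f' n x t) t := by
  obtain ⟨B, -, hf⟩ := h'.exists_bound (t + 1)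
  exact hasDerivAt_tsum_of_isPreconnected (t := Iio (t + 1)) (y₀ := t)
    (summable_geometric_two.mul_left B) isOpen_Iio isPreconnected_Iio
    (fun n y _ => hd n x y) (fun n y hy => hf n x (mem_univ _) y (le_of_lt hy)) (by simp)
    (h.summable (mem_univ x) t) (by simp)

theorem hasSum_integral_refl_mul {f : ℕ → ℝ → ℝ → ℝ}
    (h : D.GeometricDecay (Icc 0 D.len) f)
    (hc : ∀ n, Continuous fun z : ℝ × ℝ => f n z.1 z.2) {a b : ℝ} (ha : a ∈ Icc 0 D.len)
    (hb : b ∈ Icc 0 D.len) {g : ℝ → ℝ} (hg : Continuous g) :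
    HasSum (fun n => ∫ s in a..b, D.refl s * f n s (g s))
      (∫ s in a..b, D.refl s * ∑' n, f n s (g s)) := by
  obtain ⟨T, hT⟩ := (isCompact_Icc (a := (0 : ℝ)) (b := D.len)).bddAbove_image hg.continuousOn
  obtain ⟨B, hB, hf⟩ := h.exists_bound T
  have hsub : ∀ {s}, s ∈ uIoc a b → s ∈ Icc 0 D.len :=
    fun hs => (ordConnected_Icc.uIcc_subset ha hb) (uIoc_subset_uIcc hs)
  have hgT : ∀ {s}, s ∈ Icc 0 D.len → g s ≤ T := fun hs => hT (mem_image_of_mem g hs)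
  have hR := D.continuous_refl
  refine intervalIntegral.hasSum_integral_of_dominated_convergence
    (fun n _ => D.bnd * (B * (1 / 2) ^ n)) (fun n => ?_) (fun n => ?_) ?_ ?_ ?_
  · exact (hR.mul ((hc n).comp (f := fun s => (s, g s)) (by fun_prop))).aestronglyMeasurable
  · refine Eventually.of_forall fun s hs => ?_
    rw [Real.norm_eq_abs, abs_mul]
    exact mul_le_mul (D.abs_refl_le s) (hf n s (hsub hs) _ (hgT (hsub hs))) (abs_nonneg _)
      D.bnd_pos.le
  · exact Eventually.of_forall fun s _ => (summable_geometric_two.mul_left B).mul_left _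
  · exact intervalIntegrable_const
  · exact Eventually.of_forall fun s hs => (h.summable (hsub hs) _).hasSum.mul_left _

theorem hasSum_leftOp {f : ℕ → ℝ → ℝ → ℝ} (h : D.GeometricDecay (Icc 0 D.len) f)
    (hc : ∀ n, Continuous fun z : ℝ × ℝ => f n z.1 z.2) (x t : ℝ) :
    HasSum (fun n => D.leftOp (f n) x t) (D.leftOp (fun x t => ∑' n, f n x t) x t) := by
  have hτ := D.continuous_time
  exact hasSum_integral_refl_mul h hc (clampTo_mem D.len_pos x) ⟨D.len_pos.le, le_rfl⟩
    (by fun_prop)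

theorem hasSum_rightOp {f : ℕ → ℝ → ℝ → ℝ} (h : D.GeometricDecay (Icc 0 D.len) f)
    (hc : ∀ n, Continuous fun z : ℝ × ℝ => f n z.1 z.2) (x t : ℝ) :
    HasSum (fun n => D.rightOp (f n) x t) (D.rightOp (fun x t => ∑' n, f n x t) x t) := by
  have hτ := D.continuous_time
  exact (hasSum_integral_refl_mul h hc ⟨le_rfl, D.len_pos.le⟩ (clampTo_mem D.len_pos x)
    (by fun_prop)).neg

/-! ### The path sums -/

theorem exists_abs_le_of_eq_zero {q : ℝ → ℝ} (hc : Continuous q) (hq : ∀ t ≤ 0, q t = 0) (T : ℝ) :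
    ∃ B, 0 ≤ B ∧ ∀ t ≤ T, |q t| ≤ B := by
  obtain ⟨B, hB⟩ := (isCompact_Icc (a := (0 : ℝ)) (b := T)).exists_bound_of_continuousOn
    hc.continuousOn
  refine ⟨max B 0, le_max_right _ _, fun t ht => ?_⟩
  rcases le_or_gt t 0 with h | h
  · rw [hq t h, abs_zero]; exact le_max_right _ _
  · exact (hB t ⟨h.le, ht⟩).trans (le_max_left _ _)

variable (D)

theorem geometricDecay_term_odd {q : ℝ → ℝ} (hc : Continuous q) (hq : ∀ t ≤ 0, q t = 0) :
    D.GeometricDecay univ fun m => D.term q (2 * m + 1) := fun T => by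
  obtain ⟨B, hB, hqB⟩ := exists_abs_le_of_eq_zero hc hq T
  refine ⟨B, hB, fun n x _ t ht => (D.abs_term_succ_le hq hB hqB (2 * n) x t ht).trans ?_⟩
  rw [div_eq_mul_one_div, ← one_div_pow]
  gcongr ?_ * ?_ * _
  exact pow_le_pow_of_le_one (by norm_num) (by norm_num) (by omega)

theorem geometricDecay_term_even_succ {q : ℝ → ℝ} (hc : Continuous q) (hq : ∀ t ≤ 0, q t = 0) :
    D.GeometricDecay univ fun m => D.term q (2 * m + 2) := fun T => by
  obtain ⟨B, hB, hqB⟩ := exists_abs_le_of_eq_zero hc hq T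
  refine ⟨B, hB, fun n x _ t ht => (D.abs_term_succ_le hq hB hqB (2 * n + 1) x t ht).trans ?_⟩
  rw [div_eq_mul_one_div, ← one_div_pow]
  gcongr ?_ * ?_ * _
  exact pow_le_pow_of_le_one (by norm_num) (by norm_num) (by omega)

theorem geometricDecay_term_even {q : ℝ → ℝ} (hc : Continuous q) (hq : ∀ t ≤ 0, q t = 0) :
    D.GeometricDecay (Icc 0 D.len) fun m => D.term q (2 * m) := fun T => by
  obtain ⟨B, hB, hqB⟩ := exists_abs_le_of_eq_zero hc hq T
  refine ⟨B, hB, fun n x hx t ht => ?_⟩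
  cases n with
  | zero => simpa using D.abs_term_zero_le hq hB hqB hx.1 ht
  | succ n =>
    refine (D.abs_term_succ_le hq hB hqB (2 * n + 1) x t ht).trans ?_
    rw [div_eq_mul_one_div, ← one_div_pow]
    gcongr ?_ * ?_ * _
    exact pow_le_pow_of_le_one (by norm_num) (by norm_num) (by omega)

/-- With the bound `0` for the signal at times `t ≤ 0`, the exponential estimate says that nothing
has been reflected before time `0`. -/
theorem term_succ_zero {q : ℝ → ℝ} (hq : ∀ t ≤ 0, q t = 0) (n : ℕ) (x : ℝ) : D.term q (n + 1) x 0 = 0 := by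
  have := D.abs_term_succ_le (B := 0) (T := 0) hq le_rfl (fun t ht => by simp [hq t ht]) n x 0
    le_rfl
  simpa using this

/-- The sum of the contributions of all left-going paths. -/
def leftSum (q : ℝ → ℝ) (x t : ℝ) : ℝ := ∑' m, D.term q (2 * m + 1) x t

/-- The sum of the contributions of all right-going paths. -/
def rightSum (q : ℝ → ℝ) (x t : ℝ) : ℝ := ∑' m, D.term q (2 * m) x t

theorem leftSum_zero {q : ℝ → ℝ} (hq : ∀ t ≤ 0, q t = 0) (x : ℝ) : D.leftSum q x 0 = 0 := by
  simp [leftSum, D.term_succ_zero hq]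

variable {q : ℝ → ℝ} (hc : Continuous q) (hq : ∀ t ≤ 0, q t = 0)
include hc hq

theorem summable_term_odd (x t : ℝ) : Summable fun m => D.term q (2 * m + 1) x t :=
  (D.geometricDecay_term_odd hc hq).summable (mem_univ x) t

theorem summable_term_even (x t : ℝ) : Summable fun m => D.term q (2 * m) x t :=
  (summable_nat_add_iff 1).1 ((D.geometricDecay_term_even_succ hc hq).summable (mem_univ x) t)

/-- The direct path is kept apart, since for `x < 0` its contribution is not bounded uniformly
in `x`. -/
theorem rightSum_eq (x t : ℝ) :
    D.rightSum q x t = q (t - D.time x) + ∑' m, D.term q (2 * m + 2) x t := by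
  unfold rightSum
  rw [(D.summable_term_even hc hq x t).tsum_eq_zero_add]
  rfl

theorem continuous_leftSum : Continuous fun z : ℝ × ℝ => D.leftSum q z.1 z.2 :=
  (D.geometricDecay_term_odd hc hq).continuous_tsum fun _ => D.continuous_term hc _

theorem continuous_rightSum : Continuous fun z : ℝ × ℝ => D.rightSum q z.1 z.2 := by
  have hτ := D.continuous_time
  simp_rw [D.rightSum_eq hc hq]
  exact (show Continuous fun z : ℝ × ℝ => q (z.2 - D.time z.1) by fun_prop).add
    ((D.geometricDecay_term_even_succ hc hq).continuous_tsum fun _ => D.continuous_term hc _)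

theorem leftSum_eq_leftOp (x t : ℝ) : D.leftSum q x t = D.leftOp (D.rightSum q) x t := by
  unfold leftSum
  simp_rw [D.term_odd]
  exact (hasSum_leftOp (D.geometricDecay_term_even hc hq)
    (fun _ => D.continuous_term hc _) x t).tsum_eq

theorem rightSum_eq_rightOp (x t : ℝ) :
    D.rightSum q x t = q (t - D.time x) + D.rightOp (D.leftSum q) x t := by
  rw [D.rightSum_eq hc hq]
  simp_rw [D.term_even]
  congr 1
  have h : D.GeometricDecay (Icc 0 D.len) fun m => D.term q (2 * m + 1) := fun T => by
    obtain ⟨B, hB, h⟩ := D.geometricDecay_term_odd hc hq T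
    exact ⟨B, hB, fun n x _ => h n x (mem_univ x)⟩
  exact (hasSum_rightOp h (fun _ => D.continuous_term hc _) x t).tsum_eq

theorem rightSum_zero (x : ℝ) : D.rightSum q x 0 = q (-D.time x) := by
  rw [D.rightSum_eq hc hq]
  simp [D.term_succ_zero hq (_ + 1)]

variable {q' : ℝ → ℝ} (hc' : Continuous q') (hq' : ∀ t ≤ 0, q' t = 0)
  (hd : ∀ t, HasDerivAt q (q' t) t)
include hc' hq' hd

theorem hasDerivAt_leftSum (x t : ℝ) :
    HasDerivAt (fun t => D.leftSum q x t) (D.leftSum q' x t) t :=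
  (D.geometricDecay_term_odd hc hq).hasDerivAt_tsum (D.geometricDecay_term_odd hc' hq')
    (fun _ => D.hasDerivAt_term hc' hd _) x t

theorem hasDerivAt_rightSum (x t : ℝ) :
    HasDerivAt (fun t => D.rightSum q x t) (D.rightSum q' x t) t := by
  have h1 := (D.geometricDecay_term_even_succ hc hq).hasDerivAt_tsum
    (D.geometricDecay_term_even_succ hc' hq') (fun _ => D.hasDerivAt_term hc' hd _) x t
  have h2 := D.hasDerivAt_term hc' hd 0 x t
  simp_rw [D.rightSum_eq hc hq, D.rightSum_eq hc' hq']
  exact h2.add h1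

theorem hasDerivAt_leftSum_space {x t k e : ℝ}
    (hτ : HasDerivAt D.time k x) (he : HasDerivAt (clampTo D.len) e x)
    (hx : e = 0 ∨ clampTo D.len x = x) :
    HasDerivAt (fun x => D.leftSum q x t)
      (-(e * D.refl x * D.rightSum q x t) + k * D.leftSum q' x t) x := by
  have h := D.hasDerivAt_leftOp_space (t := t) (D.continuous_rightSum hc hq)
    (D.continuous_rightSum hc' hq') (D.hasDerivAt_rightSum hc hq hc' hq' hd) hτ he
  simp_rw [D.leftSum_eq_leftOp hc hq, D.leftSum_eq_leftOp hc' hq']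
  refine h.congr_deriv ?_
  rcases hx with rfl | hx
  · simp
  · rw [hx, add_sub_cancel_right]; ring

theorem hasDerivAt_rightSum_space {x t k e : ℝ}
    (hτ : HasDerivAt D.time k x) (he : HasDerivAt (clampTo D.len) e x)
    (hx : e = 0 ∨ clampTo D.len x = x) :
    HasDerivAt (fun x => D.rightSum q x t)
      (-(e * D.refl x * D.leftSum q x t) - k * D.rightSum q' x t) x := by
  have h := D.hasDerivAt_rightOp_space (t := t) (D.continuous_leftSum hc hq)
    (D.continuous_leftSum hc' hq') (D.hasDerivAt_leftSum hc hq hc' hq' hd) hτ he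
  have h0 : HasDerivAt (fun x => q (t - D.time x)) (q' (t - D.time x) * (-k)) x :=
    HasDerivAt.comp x (hd _) (hτ.const_sub t)
  simp_rw [D.rightSum_eq_rightOp hc hq, D.rightSum_eq_rightOp hc' hq']
  refine (h0.add h).congr_deriv ?_
  rcases hx with rfl | hx
  · simp; ring
  · rw [hx, sub_add_cancel]; ring

end ScatteringData

/-! ### The medium -/

theorem hasDerivAt_clampTo_of_mem {len x : ℝ} (h : x ∈ Ioo 0 len) :
    HasDerivAt (clampTo len) 1 x := by
  refine (hasDerivAt_id x).congr_of_eventuallyEq ?_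
  filter_upwards [Ioo_mem_nhds h.1 h.2] with y hy
  exact clampTo_of_mem (Ioo_subset_Icc_self hy)

theorem hasDerivAt_clampTo_of_neg {len x : ℝ} (hx : x < 0) : HasDerivAt (clampTo len) 0 x := by
  refine (hasDerivAt_const x (0 : ℝ)).congr_of_eventuallyEq ?_
  filter_upwards [Iio_mem_nhds hx] with y hy
  exact clampTo_of_nonpos (le_of_lt hy)

theorem hasDerivAt_clampTo_of_gt {len x : ℝ} (h : 0 < len) (hx : len < x) :
    HasDerivAt (clampTo len) 0 x := by
  refine (hasDerivAt_const x len).congr_of_eventuallyEq ?_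
  filter_upwards [Ioi_mem_nhds hx] with y hy
  exact clampTo_of_le h (le_of_lt hy)

namespace AcousticMedium

variable (M : AcousticMedium)

theorem impedance_pos (x : ℝ) : 0 < M.impedance x :=
  Real.sqrt_pos.2 (mul_pos (M.K_pos x) (M.ρ_pos x))

theorem soundSpeed_pos (x : ℝ) : 0 < M.soundSpeed x :=
  Real.sqrt_pos.2 (div_pos (M.K_pos x) (M.ρ_pos x))

theorem impedance_div_soundSpeed (x : ℝ) : M.impedance x / M.soundSpeed x = M.ρ x := by
  have hK := M.K_pos x
  have hρ := M.ρ_pos x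
  rw [impedance, soundSpeed, ← Real.sqrt_div (mul_pos hK hρ).le]
  rw [show M.K x * M.ρ x / (M.K x / M.ρ x) = M.ρ x ^ 2 by field_simp, Real.sqrt_sq hρ.le]

theorem impedance_mul_soundSpeed (x : ℝ) : M.impedance x * M.soundSpeed x = M.K x := by
  have hK := M.K_pos x
  have hρ := M.ρ_pos x
  rw [impedance, soundSpeed, ← Real.sqrt_mul (mul_pos hK hρ).le]
  rw [show M.K x * M.ρ x * (M.K x / M.ρ x) = M.K x ^ 2 by field_simp, Real.sqrt_sq hK.le]

theorem continuous_impedance' : Continuous M.impedance := M.continuous_impedance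

theorem impedanceLeft_pos : 0 < M.impedanceLeft := by
  have h := M.impedance_pos (-1)
  rwa [impedance, M.K_left (-1) (by norm_num), M.ρ_left (-1) (by norm_num)] at h

/-- At `x = 0` this uses the continuity of the impedance, as `K` and `ρ` may jump there. -/
theorem impedance_of_nonpos {x : ℝ} (hx : x ≤ 0) : M.impedance x = M.impedanceLeft := by
  have hcl : IsClosed {x | M.impedance x = M.impedanceLeft} :=
    isClosed_eq M.continuous_impedance' continuous_const
  have hsub : Iio (0 : ℝ) ⊆ {x | M.impedance x = M.impedanceLeft} := fun y hy => by
    simp only [mem_ofPred_eq]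
    rw [impedance, M.K_left y hy, M.ρ_left y hy, impedanceLeft]
  have := closure_minimal hsub hcl
  rw [closure_Iio] at this
  exact this hx

theorem soundSpeed_of_neg {x : ℝ} (hx : x < 0) : M.soundSpeed x = M.soundSpeedLeft := by
  rw [soundSpeed, M.K_left x hx, M.ρ_left x hx, soundSpeedLeft]

theorem soundSpeedLeft_pos : 0 < M.soundSpeedLeft := by
  rw [← M.soundSpeed_of_neg (x := -1) (by norm_num)]; exact M.soundSpeed_pos _

theorem soundSpeed_of_gt {x y : ℝ} (hx : M.xplus < x) (hy : M.xplus < y) :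
    M.soundSpeed x = M.soundSpeed y := by
  rw [soundSpeed, soundSpeed, M.K_right x hx, M.ρ_right x hx, M.K_right y hy, M.ρ_right y hy]

/-- The points at which the coefficients `K` and `ρ` are continuous. -/
def regularSet : Set ℝ := {x | ContinuousAt M.K x ∧ ContinuousAt M.ρ x}

variable {M}

theorem mem_regularSet (hK : ContDiffOn ℝ 1 M.K (Icc 0 M.xplus))
    (hρ : ContDiffOn ℝ 1 M.ρ (Icc 0 M.xplus)) {x : ℝ} (h0 : x ≠ 0) (h1 : x ≠ M.xplus) :
    x ∈ M.regularSet := by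
  rcases lt_or_gt_of_ne h0 with h0 | h0
  · exact ⟨continuousAt_const.congr (by
      filter_upwards [Iio_mem_nhds h0] with y hy using (M.K_left y hy).symm),
      continuousAt_const.congr (by
      filter_upwards [Iio_mem_nhds h0] with y hy using (M.ρ_left y hy).symm)⟩
  rcases lt_or_gt_of_ne h1 with h1 | h1
  · exact ⟨hK.continuousOn.continuousAt (Icc_mem_nhds h0 h1),
      hρ.continuousOn.continuousAt (Icc_mem_nhds h0 h1)⟩
  · exact ⟨continuousAt_const.congr (by
      filter_upwards [Ioi_mem_nhds h1] with y hy using (M.K_right y hy).symm),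
      continuousAt_const.congr (by
      filter_upwards [Ioi_mem_nhds h1] with y hy using (M.ρ_right y hy).symm)⟩

theorem compl_regularSet_subset (hK : ContDiffOn ℝ 1 M.K (Icc 0 M.xplus))
    (hρ : ContDiffOn ℝ 1 M.ρ (Icc 0 M.xplus)) : M.regularSetᶜ ⊆ {0, M.xplus} := by
  intro x hx
  by_contra h
  simp only [mem_insert_iff, mem_singleton_iff, not_or] at h
  exact hx (mem_regularSet hK hρ h.1 h.2)

theorem isOpen_regularSet (hK : ContDiffOn ℝ 1 M.K (Icc 0 M.xplus))
    (hρ : ContDiffOn ℝ 1 M.ρ (Icc 0 M.xplus)) : IsOpen M.regularSet := by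
  have hf : (M.regularSetᶜ).Finite :=
    (Set.toFinite {0, M.xplus}).subset (compl_regularSet_subset hK hρ)
  exact isClosed_compl_iff.1 hf.isClosed

theorem continuousAt_soundSpeed {x : ℝ} (hx : x ∈ M.regularSet) :
    ContinuousAt M.soundSpeed x :=
  (hx.1.div hx.2 (M.ρ_pos x).ne').sqrt

theorem continuousAt_slowness {x : ℝ} (hx : x ∈ M.regularSet) :
    ContinuousAt (fun x => 1 / M.soundSpeed x) x :=
  continuousAt_const.div (continuousAt_soundSpeed hx) (M.soundSpeed_pos x).ne'

theorem exists_slowness_bounds (hK : ContDiffOn ℝ 1 M.K (Icc 0 M.xplus))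
    (hρ : ContDiffOn ℝ 1 M.ρ (Icc 0 M.xplus)) :
    ∃ κ κ', 0 < κ ∧ ∀ x, κ ≤ 1 / M.soundSpeed x ∧ 1 / M.soundSpeed x ≤ κ' := by
  have hc : ContinuousOn (fun x => 1 / M.soundSpeed x) (Icc 0 M.xplus) :=
    continuousOn_const.div
      (hK.continuousOn.div hρ.continuousOn fun x _ => (M.ρ_pos x).ne').sqrt
      fun x _ => (M.soundSpeed_pos x).ne'
  have hne : (Icc 0 M.xplus).Nonempty := nonempty_Icc.2 M.xplus_pos.le
  obtain ⟨a, -, ha⟩ := isCompact_Icc.exists_isMinOn hne hc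
  obtain ⟨b, -, hb⟩ := isCompact_Icc.exists_isMaxOn hne hc
  have hpos : ∀ x, 0 < 1 / M.soundSpeed x := fun x => one_div_pos.2 (M.soundSpeed_pos x)
  set s := fun x => 1 / M.soundSpeed x
  refine ⟨min (s a) (min (s (-1)) (s (M.xplus + 1))), max (s b) (max (s (-1)) (s (M.xplus + 1))),
    lt_min (hpos _) (lt_min (hpos _) (hpos _)), fun x => ?_⟩
  change _ ≤ s x ∧ s x ≤ _
  rcases lt_or_ge x 0 with h0 | h0
  · have : s x = s (-1) := by
      simp only [s]; rw [M.soundSpeed_of_neg h0, M.soundSpeed_of_neg (by norm_num)]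
    rw [this]; simp
  rcases le_or_gt x M.xplus with h1 | h1
  · exact ⟨(min_le_left _ _).trans (ha ⟨h0, h1⟩), (hb ⟨h0, h1⟩ : s x ≤ s b).trans (le_max_left _ _)⟩
  · have : s x = s (M.xplus + 1) := by
      simp only [s]; rw [M.soundSpeed_of_gt h1 (y := M.xplus + 1) (by linarith)]
    rw [this]; simp

theorem intervalIntegrable_slowness (hK : ContDiffOn ℝ 1 M.K (Icc 0 M.xplus))
    (hρ : ContDiffOn ℝ 1 M.ρ (Icc 0 M.xplus)) (a b : ℝ) :
    IntervalIntegrable (fun x => 1 / M.soundSpeed x) volume a b := by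
  obtain ⟨κ, κ', hκ, h⟩ := exists_slowness_bounds hK hρ
  have hU : (M.regularSet : Set ℝ) =ᵐ[volume] univ := by
    rw [ae_eq_univ]
    exact ((Set.toFinite {0, M.xplus}).subset (compl_regularSet_subset hK hρ)).measure_zero _
  have hm : AEStronglyMeasurable (fun x => 1 / M.soundSpeed x) volume := by
    have : ContinuousOn (fun x => 1 / M.soundSpeed x) M.regularSet :=
      fun x hx => (continuousAt_slowness hx).continuousWithinAt
    have := this.aestronglyMeasurable (μ := volume) (isOpen_regularSet hK hρ).measurableSet
    rwa [Measure.restrict_congr_set hU, Measure.restrict_univ] at this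
  refine (intervalIntegrable_const (c := κ')).mono_fun hm.restrict
    (Eventually.of_forall fun x => ?_)
  simp only [Real.norm_eq_abs]
  rw [abs_of_pos (hκ.trans_le (h x).1)]
  exact (h x).2.trans (le_abs_self _)

theorem continuous_travelTime (hK : ContDiffOn ℝ 1 M.K (Icc 0 M.xplus))
    (hρ : ContDiffOn ℝ 1 M.ρ (Icc 0 M.xplus)) : Continuous M.travelTime :=
  intervalIntegral.continuous_primitive (intervalIntegrable_slowness hK hρ) 0

/-- The travel time is differentiable where the sound speed is continuous; it may have corners at
the two interfaces. -/
theorem hasDerivAt_travelTime (hK : ContDiffOn ℝ 1 M.K (Icc 0 M.xplus))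
    (hρ : ContDiffOn ℝ 1 M.ρ (Icc 0 M.xplus)) {x : ℝ} (hx : x ∈ M.regularSet) :
    HasDerivAt M.travelTime (1 / M.soundSpeed x) x := by
  refine intervalIntegral.integral_hasDerivAt_right (intervalIntegrable_slowness hK hρ 0 x) ?_
    (continuousAt_slowness hx)
  exact ContinuousOn.stronglyMeasurableAtFilter (isOpen_regularSet hK hρ)
    (fun x hx => (continuousAt_slowness hx).continuousWithinAt) x hx

theorem exists_mul_le_travelTime_sub (hK : ContDiffOn ℝ 1 M.K (Icc 0 M.xplus))
    (hρ : ContDiffOn ℝ 1 M.ρ (Icc 0 M.xplus)) :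
    ∃ κ, 0 < κ ∧ ∀ a b, a ≤ b → κ * (b - a) ≤ M.travelTime b - M.travelTime a := by
  obtain ⟨κ, κ', hκ, h⟩ := exists_slowness_bounds hK hρ
  have hi := intervalIntegrable_slowness hK hρ
  refine ⟨κ, hκ, fun a b hab => ?_⟩
  unfold travelTime
  rw [intervalIntegral.integral_interval_sub_left (hi 0 b) (hi 0 a)]
  have := intervalIntegral.integral_mono_on hab intervalIntegrable_const (hi a b)
    fun x _ => (h x).1
  simpa [mul_comm] using this

theorem travelTime_of_nonpos {x : ℝ} (hx : x ≤ 0) :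
    M.travelTime x = x / M.soundSpeedLeft := by
  unfold travelTime
  have : ∫ y in (0 : ℝ)..x, 1 / M.soundSpeed y = ∫ y in (0 : ℝ)..x, 1 / M.soundSpeedLeft := by
    refine intervalIntegral.integral_congr_ae ?_
    filter_upwards [compl_mem_ae_iff.2 (measure_singleton (0 : ℝ))] with y hy0 hy
    rw [uIoc_of_ge hx] at hy
    rw [M.soundSpeed_of_neg (lt_of_le_of_ne hy.2 hy0)]
  rw [this]; simp [div_eq_mul_inv]

theorem reflCoeff_of_neg {x : ℝ} (hx : x < 0) : M.reflCoeff x = 0 := by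
  have : deriv M.impedance x = 0 := by
    have h : M.impedance =ᶠ[𝓝 x] fun _ => M.impedanceLeft := by
      filter_upwards [Iio_mem_nhds hx] with y hy using M.impedance_of_nonpos (le_of_lt hy)
    rw [h.deriv_eq, deriv_const]
  rw [reflCoeff, this, zero_div]

theorem reflCoeff_of_gt {x : ℝ} (hx : M.xplus < x) : M.reflCoeff x = 0 := by
  have : deriv M.impedance x = 0 := by
    have h : M.impedance =ᶠ[𝓝 x] fun _ => √(M.Kplus * M.ρplus) := by
      filter_upwards [Ioi_mem_nhds hx] with y hy
      rw [impedance, M.K_right y hy, M.ρ_right y hy]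
    rw [h.deriv_eq, deriv_const]
  rw [reflCoeff, this, zero_div]

theorem contDiffOn_impedance (hK : ContDiffOn ℝ 1 M.K (Icc 0 M.xplus))
    (hρ : ContDiffOn ℝ 1 M.ρ (Icc 0 M.xplus)) : ContDiffOn ℝ 1 M.impedance (Icc 0 M.xplus) :=
  (hK.mul hρ).sqrt fun x _ => (mul_pos (M.K_pos x) (M.ρ_pos x)).ne'

theorem hasDerivAt_impedance (hK : ContDiffOn ℝ 1 M.K (Icc 0 M.xplus))
    (hρ : ContDiffOn ℝ 1 M.ρ (Icc 0 M.xplus)) {x : ℝ} (h0 : x ≠ 0) (h1 : x ≠ M.xplus) :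
    HasDerivAt M.impedance (2 * M.reflCoeff x * M.impedance x) x := by
  have hd : DifferentiableAt ℝ M.impedance x := by
    rcases lt_or_gt_of_ne h0 with h0 | h0
    · refine (differentiableAt_const M.impedanceLeft).congr_of_eventuallyEq ?_
      filter_upwards [Iio_mem_nhds h0] with y hy using M.impedance_of_nonpos (le_of_lt hy)
    rcases lt_or_gt_of_ne h1 with h1 | h1
    · exact ((contDiffOn_impedance hK hρ).contDiffAt (Icc_mem_nhds h0 h1)).differentiableAt
        one_ne_zero
    · refine (differentiableAt_const √(M.Kplus * M.ρplus)).congr_of_eventuallyEq ?_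
      filter_upwards [Ioi_mem_nhds h1] with y hy
      rw [impedance, M.K_right y hy, M.ρ_right y hy]
  refine hd.hasDerivAt.congr_deriv ?_
  have := (M.impedance_pos x).ne'
  unfold reflCoeff; field_simp

/-- At the interfaces `reflCoeff` is defined through a two-sided derivative that need not exist; the
one-sided derivatives provide a continuous substitute. -/
theorem exists_continuous_reflCoeff (hK : ContDiffOn ℝ 1 M.K (Icc 0 M.xplus))
    (hρ : ContDiffOn ℝ 1 M.ρ (Icc 0 M.xplus)) :
    ∃ (R : ℝ → ℝ) (b : ℝ), Continuous R ∧ 0 < b ∧ (∀ s, |R s| ≤ b) ∧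
      ∀ s ∈ Ioo 0 M.xplus, M.reflCoeff s = R s := by
  set g : ℝ → ℝ := fun s => derivWithin M.impedance (Icc 0 M.xplus) s / (2 * M.impedance s)
  have hg : ContinuousOn g (Icc 0 M.xplus) :=
    ((contDiffOn_impedance hK hρ).continuousOn_derivWithin (uniqueDiffOn_Icc M.xplus_pos)
      le_rfl).div (continuous_const.mul M.continuous_impedance').continuousOn
      fun x _ => (mul_pos two_pos (M.impedance_pos x)).ne'
  obtain ⟨b, hb⟩ := isCompact_Icc.exists_bound_of_continuousOn hg
  refine ⟨IccExtend M.xplus_pos.le ((Icc 0 M.xplus).domRestrict g), max b 1,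
    (continuousOn_iff_continuous_domRestrict.1 hg).Icc_extend', lt_max_of_lt_right one_pos,
    fun s => (hb _ (Subtype.coe_prop _)).trans (le_max_left _ _), fun s hs => ?_⟩
  rw [IccExtend_of_mem _ _ (Ioo_subset_Icc_self hs)]
  change _ = derivWithin M.impedance (Icc 0 M.xplus) s / (2 * M.impedance s)
  rw [derivWithin_of_mem_nhds (Icc_mem_nhds hs.1 hs.2), reflCoeff]

theorem measurable_reflCoeff : Measurable M.reflCoeff :=
  (measurable_deriv _).div (M.continuous_impedance'.measurable.const_mul 2)

theorem exists_abs_reflCoeff_le (hK : ContDiffOn ℝ 1 M.K (Icc 0 M.xplus))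
    (hρ : ContDiffOn ℝ 1 M.ρ (Icc 0 M.xplus)) : ∃ C, 0 ≤ C ∧ ∀ s, |M.reflCoeff s| ≤ C := by
  obtain ⟨R, b, -, hb, hR, hr⟩ := exists_continuous_reflCoeff hK hρ
  have ha := abs_nonneg (M.reflCoeff 0)
  have hc := abs_nonneg (M.reflCoeff M.xplus)
  refine ⟨b + |M.reflCoeff 0| + |M.reflCoeff M.xplus|, by positivity, fun s => ?_⟩
  rcases lt_trichotomy s 0 with h0 | rfl | h0
  · rw [reflCoeff_of_neg h0, abs_zero]; positivity
  · linarith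
  rcases lt_trichotomy s M.xplus with h1 | rfl | h1
  · rw [hr s ⟨h0, h1⟩]; linarith [hR s]
  · linarith
  · rw [reflCoeff_of_gt h1, abs_zero]; positivity

variable (M) in
/-- The data of the characteristic integral equations for the medium `M`: the travel time and a
continuous function that agrees with the reflection coefficient on the open interval
`(0, xplus)`. -/
def scattering (hK : ContDiffOn ℝ 1 M.K (Icc 0 M.xplus))
    (hρ : ContDiffOn ℝ 1 M.ρ (Icc 0 M.xplus)) : ScatteringData where
  len := M.xplus
  len_pos := M.xplus_pos
  refl := (exists_continuous_reflCoeff hK hρ).choose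
  continuous_refl := (exists_continuous_reflCoeff hK hρ).choose_spec.choose_spec.1
  bnd := (exists_continuous_reflCoeff hK hρ).choose_spec.choose
  bnd_pos := (exists_continuous_reflCoeff hK hρ).choose_spec.choose_spec.2.1
  abs_refl_le := (exists_continuous_reflCoeff hK hρ).choose_spec.choose_spec.2.2.1
  time := M.travelTime
  continuous_time := continuous_travelTime hK hρ
  time_zero := intervalIntegral.integral_same
  slow := (exists_mul_le_travelTime_sub hK hρ).choose
  slow_pos := (exists_mul_le_travelTime_sub hK hρ).choose_spec.1
  slow_mul_le := (exists_mul_le_travelTime_sub hK hρ).choose_spec.2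

variable (hK : ContDiffOn ℝ 1 M.K (Icc 0 M.xplus)) (hρ : ContDiffOn ℝ 1 M.ρ (Icc 0 M.xplus))

theorem scattering_refl {s : ℝ} (hs : s ∈ Ioo 0 M.xplus) :
    (M.scattering hK hρ).refl s = M.reflCoeff s :=
  ((exists_continuous_reflCoeff hK hρ).choose_spec.choose_spec.2.2.2 s hs).symm

theorem hasDerivAt_greenFactor (hK : ContDiffOn ℝ 1 M.K (Icc 0 M.xplus))
    (hρ : ContDiffOn ℝ 1 M.ρ (Icc 0 M.xplus)) {x : ℝ} (h0 : x ≠ 0) (h1 : x ≠ M.xplus) :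
    HasDerivAt M.greenFactor (M.reflCoeff x * M.greenFactor x) x := by
  have hp : 0 < M.impedance x / M.impedanceLeft := div_pos (M.impedance_pos x) M.impedanceLeft_pos
  have h := ((hasDerivAt_impedance hK hρ h0 h1).div_const M.impedanceLeft).sqrt hp.ne'
  refine h.congr_deriv ?_
  have hs := Real.sqrt_pos.2 hp
  rw [greenFactor, div_eq_iff (by positivity)]
  have := Real.mul_self_sqrt hp.le
  calc _ = 2 * M.reflCoeff x * (M.impedance x / M.impedanceLeft) := by ring
    _ = 2 * M.reflCoeff x * (√(M.impedance x / M.impedanceLeft) *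
        √(M.impedance x / M.impedanceLeft)) := by rw [this]
    _ = _ := by ring

variable (M) in
theorem greenFactor_pos (x : ℝ) : 0 < M.greenFactor x :=
  Real.sqrt_pos.2 (div_pos (M.impedance_pos x) M.impedanceLeft_pos)

variable (M) in
theorem continuous_greenFactor : Continuous M.greenFactor :=
  (M.continuous_impedance'.div_const _).sqrt

theorem greenFactor_of_nonpos {x : ℝ} (hx : x ≤ 0) : M.greenFactor x = 1 := by
  rw [greenFactor, M.impedance_of_nonpos hx, div_self M.impedanceLeft_pos.ne', Real.sqrt_one]

end AcousticMedium

/-! ### Alternating sequences and the iterated integrals -/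

theorem snoc_eq_piFinSuccAbove_symm (n : ℕ) :
    (fun z : ℝ × (Fin n → ℝ) => Fin.snoc (α := fun _ => ℝ) z.2 z.1) =
      (MeasurableEquiv.piFinSuccAbove (fun _ : Fin (n + 1) => ℝ) (Fin.last n)).symm := by
  funext z
  rw [← Fin.insertNth_last']
  rfl

theorem measurePreserving_snoc (n : ℕ) :
    MeasurePreserving (fun z : ℝ × (Fin n → ℝ) => Fin.snoc (α := fun _ => ℝ) z.2 z.1)
      (volume.prod volume) (volume : Measure (Fin (n + 1) → ℝ)) := by
  rw [snoc_eq_piFinSuccAbove_symm]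
  exact (volume_preserving_piFinSuccAbove (fun _ : Fin (n + 1) => ℝ) (Fin.last n)).symm

theorem measurableEmbedding_snoc (n : ℕ) :
    MeasurableEmbedding
      (fun z : ℝ × (Fin n → ℝ) => Fin.snoc (α := fun _ => ℝ) z.2 z.1) := by
  rw [snoc_eq_piFinSuccAbove_symm]
  exact MeasurableEquiv.measurableEmbedding _

theorem integrable_snoc {n : ℕ} {F : (Fin (n + 1) → ℝ) → ℝ} (hF : Integrable F) :
    Integrable (fun z : ℝ × (Fin n → ℝ) => F (Fin.snoc (α := fun _ => ℝ) z.2 z.1))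
      (volume.prod volume) :=
  ((measurePreserving_snoc n).integrable_comp_emb (measurableEmbedding_snoc n)).2 hF

theorem integral_eq_integral_snoc {n : ℕ} {F : (Fin (n + 1) → ℝ) → ℝ} (hF : Integrable F) :
    ∫ z, F z = ∫ s : ℝ, ∫ y : Fin n → ℝ, F (Fin.snoc (α := fun _ => ℝ) y s) := by
  rw [← (measurePreserving_snoc n).integral_comp (measurableEmbedding_snoc n),
    integral_prod _ (integrable_snoc hF)]

theorem integral_eq_integral_snoc_symm {n : ℕ} {F : (Fin (n + 1) → ℝ) → ℝ} (hF : Integrable F) :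
    ∫ z, F z = ∫ y : Fin n → ℝ, ∫ s : ℝ, F (Fin.snoc (α := fun _ => ℝ) y s) := by
  rw [← (measurePreserving_snoc n).integral_comp (measurableEmbedding_snoc n),
    integral_prod_symm _ (integrable_snoc hF)]

theorem neg_one_pow_mul_le_iff (n : ℕ) (a b : ℝ) :
    (-1) ^ n * a ≤ (-1) ^ n * b ↔ (Even n → a ≤ b) ∧ (Odd n → b ≤ a) := by
  rcases Nat.even_or_odd n with h | h
  · simp [h.neg_one_pow, h, Nat.not_odd_iff_even.2 h]
  · simp [h.neg_one_pow, h, Nat.not_even_iff_odd.2 h]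

theorem lastPoint_succ {n : ℕ} (y : Fin (n + 1) → ℝ) : lastPoint y = y (Fin.last n) := rfl

/-- A sequence with one more entry `s` is alternating if `s` lies on the correct side of the
previous last entry. For the empty sequence the convention `x₀ = 0` makes this condition void. -/
theorem snoc_mem_alternatingPaths {n : ℕ} {X : ℝ} (y : Fin n → ℝ) (s : ℝ) :
    Fin.snoc (α := fun _ => ℝ) y s ∈ alternatingPaths (n + 1) 0 X ↔
      y ∈ alternatingPaths n 0 X ∧ s ∈ Icc 0 X ∧ (-1) ^ n * lastPoint y ≤ (-1) ^ n * s := by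
  have key : ∀ (i : ℕ) (h : i < n), Fin.snoc (α := fun _ => ℝ) y s ⟨i, by omega⟩ = y ⟨i, h⟩ :=
    fun i h => Fin.snoc_castSucc (α := fun _ => ℝ) s y ⟨i, h⟩
  have keyl : Fin.snoc (α := fun _ => ℝ) y s ⟨n, by omega⟩ = s :=
    Fin.snoc_last (α := fun _ => ℝ) s y
  simp only [alternatingPaths, mem_ofPred_eq]
  rw [Fin.forall_fin_succ']
  simp only [Fin.snoc_castSucc, Fin.snoc_last]
  constructor
  · rintro ⟨⟨h1, h2⟩, h3⟩
    refine ⟨⟨h1, fun i hi => ?_⟩, h2, ?_⟩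
    · have := h3 i (by omega)
      rwa [key i (by omega), key (i + 1) hi] at this
    · cases n with
      | zero => simpa [lastPoint] using h2.1
      | succ n =>
        rw [neg_one_pow_mul_le_iff, lastPoint_succ]
        have := h3 n (by omega)
        rw [key n (by omega), keyl] at this
        refine ⟨fun he => this.2 ?_, fun ho => this.1 ?_⟩
        · exact Nat.not_even_iff_odd.1 fun h => by simp [Nat.even_add_one, h] at he
        · exact Nat.not_odd_iff_even.1 fun h => by simp [Nat.odd_add_one, h] at ho
  · rintro ⟨⟨h1, h2⟩, h3, h4⟩
    refine ⟨⟨h1, h3⟩, fun i hi => ?_⟩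
    rcases Nat.lt_or_ge (i + 1) n with h | h
    · rw [key i (by omega), key (i + 1) h]
      exact h2 i h
    · obtain rfl : n = i + 1 := by omega
      rw [neg_one_pow_mul_le_iff, lastPoint_succ] at h4
      rw [key i (by omega), keyl]
      exact ⟨fun he => h4.2 he.add_one, fun ho => h4.1 ho.add_one⟩

theorem isClosed_alternatingPaths (n : ℕ) (α β : ℝ) : IsClosed (alternatingPaths n α β) := by
  have : alternatingPaths n α β = (⋂ i, {x : Fin n → ℝ | x i ∈ Icc α β}) ∩
      ⋂ (i : ℕ) (h : i + 1 < n), ({x : Fin n → ℝ | Even i →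
          x ⟨i + 1, h⟩ ≤ x ⟨i, Nat.lt_of_succ_lt h⟩} ∩
        {x : Fin n → ℝ | Odd i → x ⟨i, Nat.lt_of_succ_lt h⟩ ≤ x ⟨i + 1, h⟩}) := by
    ext x; simp [alternatingPaths, IsAlternating]
  rw [this]
  refine (isClosed_iInter fun i => isClosed_Icc.preimage (continuous_apply i)).inter
    (isClosed_iInter fun i => isClosed_iInter fun h => IsClosed.inter ?_ ?_)
  · by_cases he : Even i
    · simpa only [he, true_imp_iff] using
        isClosed_le (continuous_apply (A := fun _ => ℝ) (⟨i + 1, h⟩ : Fin n))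
          (continuous_apply (A := fun _ => ℝ) (⟨i, Nat.lt_of_succ_lt h⟩ : Fin n))
    · simp [he]
  · by_cases ho : Odd i
    · simpa only [ho, true_imp_iff] using
        isClosed_le (continuous_apply (A := fun _ => ℝ) (⟨i, Nat.lt_of_succ_lt h⟩ : Fin n))
          (continuous_apply (A := fun _ => ℝ) (⟨i + 1, h⟩ : Fin n))
    · simp [ho]

theorem isCompact_alternatingPaths (n : ℕ) (α β : ℝ) : IsCompact (alternatingPaths n α β) := by
  refine (isCompact_univ_pi fun _ : Fin n => isCompact_Icc (a := α) (b := β)).of_isClosed_subset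
    (isClosed_alternatingPaths n α β) fun x hx => ?_
  exact mem_univ_pi.2 hx.1

namespace AcousticMedium

variable {M : AcousticMedium}

theorem pathTime_snoc {n : ℕ} (y : Fin n → ℝ) (s : ℝ) :
    M.pathTime (Fin.snoc (α := fun _ => ℝ) y s) =
      M.pathTime y + 2 * ((-1) ^ n * M.travelTime s) := by
  simp only [pathTime, Fin.sum_univ_castSucc, Fin.snoc_castSucc, Fin.snoc_last, Fin.val_castSucc,
    Fin.val_last]
  ring

theorem prod_reflCoeff_snoc {n : ℕ} (y : Fin n → ℝ) (s : ℝ) :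
    ∏ j, M.reflCoeff (Fin.snoc (α := fun _ => ℝ) y s j) =
      (∏ j, M.reflCoeff (y j)) * M.reflCoeff s := by
  simp only [Fin.prod_univ_castSucc, Fin.snoc_castSucc, Fin.snoc_last]

variable (M) in
/-- The sequences of `n + 1` reflection points of the paths that arrive at `x`. -/
def pathRegion (n : ℕ) (x : ℝ) : Set (Fin (n + 1) → ℝ) :=
  {z | z ∈ alternatingPaths (n + 1) 0 M.xplus ∧ (-1) ^ n * x ≤ (-1) ^ n * z (Fin.last n)}

variable (M) in
/-- The contribution, up to a sign, of the path with reflection points `z` that arrives at `(x, t)`,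
going to the left if `n + 1` is odd and to the right if `n + 1` is even. -/
def pathWeight (q : ℝ → ℝ) (n : ℕ) (x t : ℝ) (z : Fin (n + 1) → ℝ) : ℝ :=
  (∏ j, M.reflCoeff (z j)) * q (t - M.pathTime z + (-1) ^ n * M.travelTime x)

variable (M) in
/-- The integral of `pathWeight` over all paths with `n + 1` reflections that arrive at `(x, t)`. -/
def pathIntegral (q : ℝ → ℝ) (n : ℕ) (x t : ℝ) : ℝ :=
  ∫ z in M.pathRegion n x, M.pathWeight q n x t z

theorem measurableSet_pathRegion (n : ℕ) (x : ℝ) : MeasurableSet (M.pathRegion n x) :=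
  ((isClosed_alternatingPaths (n + 1) 0 M.xplus).inter
    (isClosed_le continuous_const (continuous_const.mul (continuous_apply _)))).measurableSet

theorem continuous_pathTime (hτ : Continuous M.travelTime) (n : ℕ) :
    Continuous fun z : Fin n → ℝ => M.pathTime z := by
  unfold pathTime; fun_prop

theorem integrableOn_pathWeight (hK : ContDiffOn ℝ 1 M.K (Icc 0 M.xplus))
    (hρ : ContDiffOn ℝ 1 M.ρ (Icc 0 M.xplus)) {q : ℝ → ℝ} (hq : Continuous q) (n : ℕ) (x t : ℝ) :
    IntegrableOn (M.pathWeight q n x t) (M.pathRegion n x) := by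
  have hτ := continuous_travelTime hK hρ
  have hpt := continuous_pathTime hτ (n + 1)
  obtain ⟨C, hC0, hC⟩ := exists_abs_reflCoeff_le hK hρ
  have hcomp := isCompact_alternatingPaths (n + 1) 0 M.xplus
  have hqc : Continuous fun z : Fin (n + 1) → ℝ =>
      q (t - M.pathTime z + (-1) ^ n * M.travelTime x) := by fun_prop
  obtain ⟨B, hB⟩ := hcomp.exists_bound_of_continuousOn hqc.continuousOn
  have hsub : M.pathRegion n x ⊆ alternatingPaths (n + 1) 0 M.xplus := fun z hz => hz.1
  have hm : Measurable fun z : Fin (n + 1) → ℝ => ∏ j, M.reflCoeff (z j) :=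
    Finset.measurable_fun_prod _ fun j _ => measurable_reflCoeff.comp (measurable_pi_apply j)
  refine Measure.integrableOn_of_bounded (M := C ^ (n + 1) * B)
    ((measure_mono hsub).trans_lt hcomp.measure_lt_top).ne
    (hm.mul hqc.measurable).aestronglyMeasurable ?_
  refine (ae_restrict_mem (measurableSet_pathRegion n x)).mono fun z hz => ?_
  rw [Real.norm_eq_abs, pathWeight, abs_mul]
  refine mul_le_mul ?_ (hB z (hsub hz)) (abs_nonneg _) (by positivity)
  rw [Finset.abs_prod]
  calc ∏ j, |M.reflCoeff (z j)| ≤ ∏ _j : Fin (n + 1), C :=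
        Finset.prod_le_prod (fun _ _ => abs_nonneg _) fun j _ => hC _
    _ = C ^ (n + 1) := by simp

/-- The positions of the last reflection point of the paths that arrive at `x`, when the earlier
reflection points are `y`. -/
def lastRange (X : ℝ) {n : ℕ} (x : ℝ) (y : Fin n → ℝ) : Set ℝ :=
  {s | s ∈ Icc 0 X ∧ (-1) ^ n * lastPoint y ≤ (-1) ^ n * s ∧ (-1) ^ n * x ≤ (-1) ^ n * s}

theorem measurableSet_lastRange (X : ℝ) {n : ℕ} (x : ℝ) (y : Fin n → ℝ) :
    MeasurableSet (lastRange X x y) := by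
  refine IsClosed.measurableSet (isClosed_Icc.inter (IsClosed.inter ?_ ?_))
  · exact isClosed_le continuous_const (continuous_const.mul continuous_id)
  · exact isClosed_le continuous_const (continuous_const.mul continuous_id)

theorem snoc_mem_pathRegion {n : ℕ} {x : ℝ} {y : Fin n → ℝ} {s : ℝ} :
    Fin.snoc (α := fun _ => ℝ) y s ∈ M.pathRegion n x ↔
      y ∈ alternatingPaths n 0 M.xplus ∧ s ∈ lastRange M.xplus x y := by
  simp only [pathRegion, mem_ofPred_eq, snoc_mem_alternatingPaths, Fin.snoc_last, lastRange,
    and_assoc]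

theorem pathWeight_snoc (q : ℝ → ℝ) (n : ℕ) (x t : ℝ) (y : Fin n → ℝ) (s : ℝ) :
    M.pathWeight q n x t (Fin.snoc (α := fun _ => ℝ) y s) =
      (∏ j, M.reflCoeff (y j)) * (M.reflCoeff s *
        q (t - (M.pathTime y + 2 * ((-1) ^ n * M.travelTime s)) +
          (-1) ^ n * M.travelTime x)) := by
  rw [pathWeight, prod_reflCoeff_snoc, pathTime_snoc, mul_assoc]

theorem indicator_pathWeight_snoc (q : ℝ → ℝ) (n : ℕ) (x t : ℝ) (y : Fin n → ℝ) (s : ℝ) :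
    (M.pathRegion n x).indicator (M.pathWeight q n x t) (Fin.snoc (α := fun _ => ℝ) y s) =
      (alternatingPaths n 0 M.xplus).indicator (fun y => (∏ j, M.reflCoeff (y j)) *
        (lastRange M.xplus x y).indicator (fun s => M.reflCoeff s *
          q (t - (M.pathTime y + 2 * ((-1) ^ n * M.travelTime s)) + (-1) ^ n * M.travelTime x))
          s) y := by
  by_cases h1 : y ∈ alternatingPaths n 0 M.xplus
  · rw [indicator_of_mem h1]
    by_cases h2 : s ∈ lastRange M.xplus x y
    · rw [indicator_of_mem (snoc_mem_pathRegion.2 ⟨h1, h2⟩), indicator_of_mem h2, pathWeight_snoc]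
    · rw [indicator_of_notMem (fun h => h2 (snoc_mem_pathRegion.1 h).2), indicator_of_notMem h2,
        mul_zero]
  · rw [indicator_of_notMem (fun h => h1 (snoc_mem_pathRegion.1 h).1), indicator_of_notMem h1]

theorem integral_indicator_pathWeight_snoc (q : ℝ → ℝ) (n : ℕ) (x t : ℝ) (y : Fin n → ℝ) :
    ∫ s, (M.pathRegion n x).indicator (M.pathWeight q n x t) (Fin.snoc (α := fun _ => ℝ) y s) =
      (alternatingPaths n 0 M.xplus).indicator (fun y => (∏ j, M.reflCoeff (y j)) *
        ∫ s in lastRange M.xplus x y, M.reflCoeff s *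
          q (t - (M.pathTime y + 2 * ((-1) ^ n * M.travelTime s)) + (-1) ^ n * M.travelTime x))
          y := by
  simp only [indicator_pathWeight_snoc]
  by_cases h1 : y ∈ alternatingPaths n 0 M.xplus
  · simp only [indicator_of_mem h1]
    rw [integral_const_mul, integral_indicator (measurableSet_lastRange _ _ _)]
  · simp only [indicator_of_notMem h1, integral_zero]

variable (hK : ContDiffOn ℝ 1 M.K (Icc 0 M.xplus)) (hρ : ContDiffOn ℝ 1 M.ρ (Icc 0 M.xplus))
include hK hρ

theorem integrableOn_outer {q : ℝ → ℝ} (hq : Continuous q) (n : ℕ) (x t : ℝ) :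
    IntegrableOn (fun y : Fin n → ℝ => (∏ j, M.reflCoeff (y j)) *
        ∫ s in lastRange M.xplus x y, M.reflCoeff s *
          q (t - (M.pathTime y + 2 * ((-1) ^ n * M.travelTime s)) + (-1) ^ n * M.travelTime x))
      (alternatingPaths n 0 M.xplus) := by
  have h := (integrableOn_pathWeight hK hρ hq n x t).integrable_indicator
    (measurableSet_pathRegion n x)
  have := (integrable_snoc h).integral_prod_right
  simp only [integral_indicator_pathWeight_snoc] at this
  exact (integrable_indicator_iff (isClosed_alternatingPaths n 0 M.xplus).measurableSet).1 this

/-- The iterated integral, with the last reflection point innermost, is an integral over all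
reflection points. -/
theorem integral_outer_eq_pathIntegral {q : ℝ → ℝ} (hq : Continuous q) (n : ℕ) (x t : ℝ) :
    ∫ y in alternatingPaths n 0 M.xplus, (∏ j, M.reflCoeff (y j)) *
        ∫ s in lastRange M.xplus x y, M.reflCoeff s *
          q (t - (M.pathTime y + 2 * ((-1) ^ n * M.travelTime s)) + (-1) ^ n * M.travelTime x) =
      M.pathIntegral q n x t := by
  have h := (integrableOn_pathWeight hK hρ hq n x t).integrable_indicator
    (measurableSet_pathRegion n x)
  rw [pathIntegral, ← integral_indicator (measurableSet_pathRegion n x),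
    integral_eq_integral_snoc_symm h]
  simp only [integral_indicator_pathWeight_snoc]
  rw [integral_indicator (isClosed_alternatingPaths n 0 M.xplus).measurableSet]

theorem pathIntegral_zero {q : ℝ → ℝ} (hq : Continuous q) (x t : ℝ) :
    M.pathIntegral q 0 x t = ∫ s in Icc 0 M.xplus ∩ Ici x,
      M.reflCoeff s * q (t + M.travelTime x - M.travelTime s - M.travelTime s) := by
  rw [← integral_outer_eq_pathIntegral hK hρ hq]
  have huniv : alternatingPaths 0 0 M.xplus = univ := by
    ext y; simp [alternatingPaths, IsAlternating]
  have hS : ∀ y : Fin 0 → ℝ, lastRange M.xplus x y = Icc 0 M.xplus ∩ Ici x := fun y => by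
    ext s
    simp only [lastRange, lastPoint, mem_ofPred_eq, mem_inter_iff, mem_Ici, pow_zero, one_mul]
    exact ⟨fun h => ⟨h.1, h.2.2⟩, fun h => ⟨h.1, h.1.1, h.2⟩⟩
  rw [huniv, Measure.restrict_univ, Measure.volume_pi_eq_dirac (Fin.elim0 : Fin 0 → ℝ),
    integral_dirac, hS]
  simp only [Finset.univ_eq_empty, Finset.prod_empty, one_mul, pathTime, Finset.sum_empty,
    mul_zero, zero_add, pow_zero]
  refine integral_congr_ae (Eventually.of_forall fun s => ?_)
  simp only
  congr 2; ring

/-- Conditioning on the last reflection point, instead, gives the recursion along the last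
segment of the path. -/
theorem pathIntegral_succ {q : ℝ → ℝ} (hq : Continuous q) (n : ℕ) (x t : ℝ) :
    M.pathIntegral q (n + 1) x t =
      ∫ s in Icc 0 M.xplus ∩ {s | (-1) ^ (n + 1) * x ≤ (-1) ^ (n + 1) * s}, M.reflCoeff s *
        M.pathIntegral q n s (t + (-1) ^ (n + 1) * (M.travelTime x - M.travelTime s)) := by
  have h := (integrableOn_pathWeight hK hρ hq (n + 1) x t).integrable_indicator
    (measurableSet_pathRegion (n + 1) x)
  have hm : MeasurableSet
      (Icc 0 M.xplus ∩ {s : ℝ | (-1) ^ (n + 1) * x ≤ (-1) ^ (n + 1) * s}) :=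
    (isClosed_Icc.inter
      (isClosed_le continuous_const (continuous_const.mul continuous_id))).measurableSet
  rw [pathIntegral, ← integral_indicator (measurableSet_pathRegion (n + 1) x),
    integral_eq_integral_snoc h, ← integral_indicator hm]
  congr 1; ext s
  have key : ∀ y : Fin (n + 1) → ℝ,
      (M.pathRegion (n + 1) x).indicator (M.pathWeight q (n + 1) x t)
        (Fin.snoc (α := fun _ => ℝ) y s) =
      (Icc 0 M.xplus ∩ {s : ℝ | (-1) ^ (n + 1) * x ≤ (-1) ^ (n + 1) * s}).indicator
        (fun s => M.reflCoeff s * (M.pathRegion n s).indicator (M.pathWeight q n s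
          (t + (-1) ^ (n + 1) * (M.travelTime x - M.travelTime s))) y) s := by
    intro y
    have hlast : (-1 : ℝ) ^ (n + 1) * lastPoint y ≤ (-1) ^ (n + 1) * s ↔
        (-1) ^ n * s ≤ (-1) ^ n * y (Fin.last n) := by
      rw [lastPoint_succ, pow_succ]
      constructor <;> intro h <;> linarith
    have hmem : Fin.snoc (α := fun _ => ℝ) y s ∈ M.pathRegion (n + 1) x ↔
        s ∈ Icc 0 M.xplus ∩ {s : ℝ | (-1) ^ (n + 1) * x ≤ (-1) ^ (n + 1) * s} ∧
          y ∈ M.pathRegion n s := by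
      rw [snoc_mem_pathRegion]
      simp only [lastRange, pathRegion, mem_ofPred_eq, hlast, mem_inter_iff]
      tauto
    by_cases h1 : s ∈ Icc 0 M.xplus ∩ {s : ℝ | (-1) ^ (n + 1) * x ≤ (-1) ^ (n + 1) * s}
    · rw [indicator_of_mem h1]
      by_cases h2 : y ∈ M.pathRegion n s
      · rw [indicator_of_mem (hmem.2 ⟨h1, h2⟩), indicator_of_mem h2, pathWeight_snoc, pathWeight,
          mul_left_comm]
        congr 3
        rw [pow_succ]; ring
      · rw [indicator_of_notMem (fun h => h2 (hmem.1 h).2), indicator_of_notMem h2, mul_zero]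
    · rw [indicator_of_notMem (fun h => h1 (hmem.1 h).1), indicator_of_notMem h1]
  simp only [key]
  by_cases h1 : s ∈ Icc 0 M.xplus ∩ {s : ℝ | (-1) ^ (n + 1) * x ≤ (-1) ^ (n + 1) * s}
  · simp only [indicator_of_mem h1]
    rw [integral_const_mul, integral_indicator (measurableSet_pathRegion n s), pathIntegral]
  · simp only [indicator_of_notMem h1, integral_zero]

end AcousticMedium

namespace AcousticMedium

variable {M : AcousticMedium}

/-! ### The iterated integrals as terms of the series -/

theorem ae_notMem_triple (a b c : ℝ) : ∀ᵐ s : ℝ, s ≠ a ∧ s ≠ b ∧ s ≠ c := by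
  filter_upwards [compl_mem_ae_iff.2 (measure_singleton a),
    compl_mem_ae_iff.2 (measure_singleton b), compl_mem_ae_iff.2 (measure_singleton c)]
    with s h1 h2 h3 using ⟨h1, h2, h3⟩

/-- For `a > xplus` the interval integral runs backwards over points where `r` vanishes, so it agrees
with the integral over the empty set. -/
theorem interval_reflCoeff_left (a : ℝ) (h : ℝ → ℝ) :
    ∫ s in a..M.xplus, M.reflCoeff s * h s =
      ∫ s in Icc 0 M.xplus ∩ Ici a, M.reflCoeff s * h s := by
  have hm : MeasurableSet (Icc 0 M.xplus ∩ Ici a) := measurableSet_Icc.inter measurableSet_Ici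
  rcases le_or_gt a M.xplus with ha | ha
  · rw [intervalIntegral.integral_of_le ha, ← integral_indicator measurableSet_Ioc,
      ← integral_indicator hm]
    refine integral_congr_ae ?_
    filter_upwards [ae_notMem_triple 0 M.xplus a] with s hs
    simp only [indicator_apply, mem_Ioc, mem_inter_iff, mem_Icc, mem_Ici]
    rcases lt_or_ge s 0 with h0 | h0
    · simp [reflCoeff_of_neg h0]
    · refine if_congr ⟨fun h => ⟨⟨h0, h.2⟩, h.1.le⟩, fun h => ⟨?_, h.1.2⟩⟩ rfl rfl
      exact lt_of_le_of_ne h.2 hs.2.2.symm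
  · have : Icc 0 M.xplus ∩ Ici a = ∅ := by
      ext s; simp only [mem_inter_iff, mem_Icc, mem_Ici, mem_empty_iff_false, iff_false]
      exact fun h => absurd (h.1.2.trans_lt ha) (not_lt.2 h.2)
    rw [this, Measure.restrict_empty, integral_zero_measure]
    refine intervalIntegral.integral_zero_ae (Eventually.of_forall fun s hs => ?_)
    rw [uIoc_of_ge ha.le] at hs
    rw [reflCoeff_of_gt hs.1, zero_mul]

/-- For `b < 0` the interval integral runs backwards over points where `r` vanishes, so it agrees
with the integral over the empty set. -/
theorem interval_reflCoeff_right (b : ℝ) (h : ℝ → ℝ) :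
    ∫ s in (0 : ℝ)..b, M.reflCoeff s * h s =
      ∫ s in Icc 0 M.xplus ∩ Iic b, M.reflCoeff s * h s := by
  have hm : MeasurableSet (Icc 0 M.xplus ∩ Iic b) := measurableSet_Icc.inter measurableSet_Iic
  rcases le_or_gt 0 b with hb | hb
  · rw [intervalIntegral.integral_of_le hb, ← integral_indicator measurableSet_Ioc,
      ← integral_indicator hm]
    refine integral_congr_ae ?_
    filter_upwards [ae_notMem_triple 0 M.xplus b] with s hs
    simp only [indicator_apply, mem_Ioc, mem_inter_iff, mem_Icc, mem_Iic]
    rcases lt_or_ge M.xplus s with h0 | h0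
    · simp [reflCoeff_of_gt h0]
    · refine if_congr ⟨fun h => ⟨⟨h.1.le, h0⟩, h.2⟩, fun h => ⟨?_, h.2⟩⟩ rfl rfl
      exact lt_of_le_of_ne h.1.1 hs.1.symm
  · have : Icc 0 M.xplus ∩ Iic b = ∅ := by
      ext s; simp only [mem_inter_iff, mem_Icc, mem_Iic, mem_empty_iff_false, iff_false]
      exact fun h => absurd (h.2.trans_lt hb) (not_lt.2 h.1.1)
    rw [this, Measure.restrict_empty, integral_zero_measure]
    refine intervalIntegral.integral_zero_ae ?_
    filter_upwards [ae_notMem_triple 0 0 0] with s hs0 hs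
    rw [uIoc_of_ge hb.le] at hs
    rw [reflCoeff_of_neg (lt_of_le_of_ne hs.2 hs0.1), zero_mul]

variable (hK : ContDiffOn ℝ 1 M.K (Icc 0 M.xplus)) (hρ : ContDiffOn ℝ 1 M.ρ (Icc 0 M.xplus))

theorem leftOp_eq (f : ℝ → ℝ → ℝ) (x t : ℝ) :
    (M.scattering hK hρ).leftOp f x t = ∫ s in Icc 0 M.xplus ∩ Ici x,
      M.reflCoeff s * f s (t + M.travelTime x - M.travelTime s) := by
  change ∫ s in (clampTo M.xplus x)..M.xplus,
    (M.scattering hK hρ).refl s * f s (t + M.travelTime x - M.travelTime s) = _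
  have hc := clampTo_mem M.xplus_pos x
  rw [intervalIntegral.integral_of_le hc.2, ← integral_indicator measurableSet_Ioc,
    ← integral_indicator (measurableSet_Icc.inter measurableSet_Ici)]
  refine integral_congr_ae ?_
  filter_upwards [ae_notMem_triple 0 M.xplus x] with s hs
  simp only [indicator_apply, mem_Ioc, mem_inter_iff, mem_Icc, mem_Ici]
  by_cases h : s ∈ Ioo 0 M.xplus
  · rw [scattering_refl hK hρ h]
    refine if_congr ?_ rfl rfl
    simp only [clampTo, max_lt_iff, min_lt_iff, h.1, h.2.le, true_and, and_true]
    constructor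
    · rintro (h1 | h1)
      · exact ⟨h.1.le, h1.le⟩
      · exact absurd h1 (not_lt.2 h.2.le)
    · exact fun h1 => Or.inl (lt_of_le_of_ne h1.2 hs.2.2.symm)
  · have h' : ¬ (0 ≤ s ∧ s ≤ M.xplus) := fun h1 =>
      h ⟨lt_of_le_of_ne h1.1 hs.1.symm, lt_of_le_of_ne h1.2 hs.2.1⟩
    rw [if_neg (fun h1 => h' ⟨hc.1.trans h1.1.le, h1.2⟩), if_neg (fun h1 => h' h1.1)]

theorem rightOp_eq (f : ℝ → ℝ → ℝ) (x t : ℝ) :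
    (M.scattering hK hρ).rightOp f x t = -∫ s in Icc 0 M.xplus ∩ Iic x,
      M.reflCoeff s * f s (t - M.travelTime x + M.travelTime s) := by
  change -∫ s in (0 : ℝ)..(clampTo M.xplus x),
    (M.scattering hK hρ).refl s * f s (t - M.travelTime x + M.travelTime s) = _
  have hc := clampTo_mem M.xplus_pos x
  rw [intervalIntegral.integral_of_le hc.1, ← integral_indicator measurableSet_Ioc,
    ← integral_indicator (measurableSet_Icc.inter measurableSet_Iic)]
  congr 1
  refine integral_congr_ae ?_
  filter_upwards [ae_notMem_triple 0 M.xplus x] with s hs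
  simp only [indicator_apply, mem_Ioc, mem_inter_iff, mem_Icc, mem_Iic]
  by_cases h : s ∈ Ioo 0 M.xplus
  · rw [scattering_refl hK hρ h]
    refine if_congr ?_ rfl rfl
    simp only [clampTo, le_max_iff, le_min_iff, h.1, h.1.le, h.2.le, true_and, and_true,
      not_le.2 h.1, false_or]
  · have h' : ¬ (0 ≤ s ∧ s ≤ M.xplus) := fun h1 =>
      h ⟨lt_of_le_of_ne h1.1 hs.1.symm, lt_of_le_of_ne h1.2 hs.2.1⟩
    rw [if_neg (fun h1 => h' ⟨h1.1.le, h1.2.trans hc.2⟩), if_neg (fun h1 => h' h1.1)]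

theorem term_even_eq_pathIntegral {q : ℝ → ℝ} (hq : Continuous q) (m : ℕ)
    (h : ∀ x t, (M.scattering hK hρ).term q (2 * m + 1) x t =
      (-1) ^ m * M.pathIntegral q (2 * m) x t) (x t : ℝ) :
    (M.scattering hK hρ).term q (2 * m + 2) x t =
      (-1) ^ (m + 1) * M.pathIntegral q (2 * m + 1) x t := by
  have ho : Odd (2 * m + 1) := odd_two_mul_add_one m
  rw [ScatteringData.term_even, rightOp_eq, pathIntegral_succ hK hρ hq]
  simp only [ho.neg_one_pow, h]
  rw [pow_succ, mul_neg_one, neg_mul, ← integral_const_mul]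
  congr 1
  have hS : {s : ℝ | -1 * x ≤ -1 * s} = Iic x := by ext s; simp
  rw [hS]
  refine integral_congr_ae (Eventually.of_forall fun s => ?_)
  simp only
  rw [mul_left_comm]
  congr 3; ring

theorem term_odd_eq_pathIntegral {q : ℝ → ℝ} (hq : Continuous q) (m : ℕ) (x t : ℝ) :
    (M.scattering hK hρ).term q (2 * m + 1) x t = (-1) ^ m * M.pathIntegral q (2 * m) x t := by
  induction m generalizing x t with
  | zero =>
    rw [ScatteringData.term_odd, leftOp_eq]
    simp only [mul_zero, pow_zero, one_mul]
    rw [pathIntegral_zero hK hρ hq]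
    rfl
  | succ m ih =>
    have he : Even (2 * m + 1 + 1) := ⟨m + 1, by ring⟩
    rw [ScatteringData.term_odd, leftOp_eq, show 2 * (m + 1) = 2 * m + 1 + 1 by ring,
      pathIntegral_succ hK hρ hq]
    simp only [he.neg_one_pow, one_mul]
    rw [← integral_const_mul]
    change _ = ∫ s in Icc 0 M.xplus ∩ Ici x, _
    refine integral_congr_ae (Eventually.of_forall fun s => ?_)
    simp only
    rw [term_even_eq_pathIntegral hK hρ hq m ih, mul_left_comm]
    congr 3; ring

theorem innerR_eq (p₀ : ℝ → ℝ) {n : ℕ} (hn : Even n) (x t : ℝ) (y : Fin n → ℝ) (s : ℝ) :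
    M.innerR p₀ x t y s = M.reflCoeff s * p₀ (-M.soundSpeedLeft *
      (t - (M.pathTime y + 2 * ((-1) ^ n * M.travelTime s)) + (-1) ^ n * M.travelTime x)) := by
  rw [innerR, startR, pathTime_snoc, mul_comm]
  simp only [hn.neg_one_pow, one_mul]

theorem innerT_eq (p₀ : ℝ → ℝ) {n : ℕ} (hn : Odd n) (x t : ℝ) (y : Fin n → ℝ) (s : ℝ) :
    M.innerT p₀ x t y s = M.reflCoeff s * p₀ (-M.soundSpeedLeft *
      (t - (M.pathTime y + 2 * ((-1) ^ n * M.travelTime s)) + (-1) ^ n * M.travelTime x)) := by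
  rw [innerT, startT, pathTime_snoc, mul_comm]
  simp only [hn.neg_one_pow, neg_one_mul, ← sub_eq_add_neg]

theorem outerR_eq (p₀ : ℝ → ℝ) {n : ℕ} (hn : Even n) (x t : ℝ) (y : Fin n → ℝ) :
    M.outerR p₀ x t y = (∏ j, M.reflCoeff (y j)) * ∫ s in lastRange M.xplus x y,
      M.reflCoeff s * p₀ (-M.soundSpeedLeft *
        (t - (M.pathTime y + 2 * ((-1) ^ n * M.travelTime s)) + (-1) ^ n * M.travelTime x)) := by
  have hS : lastRange M.xplus x y = Icc 0 M.xplus ∩ Ici (max x (lastPoint y)) := by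
    ext s
    simp only [lastRange, hn.neg_one_pow, one_mul, mem_ofPred_eq, mem_inter_iff, mem_Ici,
      max_le_iff]
    tauto
  rw [outerR, hS, ← interval_reflCoeff_left]
  simp only [innerR_eq p₀ hn]

theorem outerT_eq (p₀ : ℝ → ℝ) {n : ℕ} (hn : Odd n) (x t : ℝ) (y : Fin n → ℝ) :
    M.outerT p₀ x t y = (∏ j, M.reflCoeff (y j)) * ∫ s in lastRange M.xplus x y,
      M.reflCoeff s * p₀ (-M.soundSpeedLeft *
        (t - (M.pathTime y + 2 * ((-1) ^ n * M.travelTime s)) + (-1) ^ n * M.travelTime x)) := by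
  have hS : lastRange M.xplus x y = Icc 0 M.xplus ∩ Iic (min x (lastPoint y)) := by
    ext s
    simp only [lastRange, hn.neg_one_pow, neg_one_mul, neg_le_neg_iff, mem_ofPred_eq,
      mem_inter_iff, mem_Iic, le_min_iff]
    tauto
  rw [outerT, hS, ← interval_reflCoeff_right]
  simp only [innerT_eq p₀ hn]

variable (M) in
/-- The signal that enters the medium at `x = 0`, as a function of time. -/
def signal (p₀ : ℝ → ℝ) (t : ℝ) : ℝ := p₀ (-M.soundSpeedLeft * t)

theorem continuous_signal {p₀ : ℝ → ℝ} (hp₀ : Continuous p₀) : Continuous (M.signal p₀) := by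
  unfold signal; fun_prop

theorem signal_of_nonpos {p₀ : ℝ → ℝ} (h : ∀ x, 0 ≤ x → p₀ x = 0) {t : ℝ} (ht : t ≤ 0) :
    M.signal p₀ t = 0 :=
  h _ (mul_nonneg_of_nonpos_of_nonpos (neg_nonpos.2 M.soundSpeedLeft_pos.le) ht)

theorem wOne_eq {p₀ : ℝ → ℝ} (hp₀ : Continuous p₀) (m : ℕ) (x t : ℝ) :
    M.wOne p₀ m x t =
      M.greenFactor x * (M.scattering hK hρ).term (M.signal p₀) (2 * m + 1) x t := by
  rw [term_odd_eq_pathIntegral hK hρ (continuous_signal hp₀),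
    ← integral_outer_eq_pathIntegral hK hρ (continuous_signal hp₀), wOne]
  simp only [outerR_eq p₀ (even_two_mul m), signal]
  ring

theorem wTwo_eq {p₀ : ℝ → ℝ} (hp₀ : Continuous p₀) (m : ℕ) (x t : ℝ) :
    M.wTwo p₀ m x t =
      M.greenFactor x * (M.scattering hK hρ).term (M.signal p₀) (2 * m) x t := by
  cases m with
  | zero =>
    simp only [wTwo, startT, pathTime, Finset.univ_eq_empty, Finset.sum_empty, mul_zero, sub_zero]
    rfl
  | succ m =>
    rw [show 2 * (m + 1) = 2 * m + 2 by ring,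
      term_even_eq_pathIntegral hK hρ (continuous_signal hp₀) m
        (term_odd_eq_pathIntegral hK hρ (continuous_signal hp₀) m),
      ← integral_outer_eq_pathIntegral hK hρ (continuous_signal hp₀), wTwo]
    simp only [outerT_eq p₀ (odd_two_mul_add_one m), signal]
    ring

include hK hρ

theorem intervalIntegrable_reflCoeff_mul {g : ℝ → ℝ} (hg : Continuous g) (a b : ℝ) :
    IntervalIntegrable (fun s => M.reflCoeff s * g s) volume a b := by
  obtain ⟨C, -, hC⟩ := exists_abs_reflCoeff_le hK hρ
  have h : IntervalIntegrable M.reflCoeff volume a b := by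
    refine (intervalIntegrable_const (c := C)).mono_fun
      measurable_reflCoeff.aestronglyMeasurable.restrict (Eventually.of_forall fun s => ?_)
    exact (hC s).trans (le_abs_self C)
  exact h.mul_continuousOn hg.continuousOn

theorem termsWellDefined {p₀ : ℝ → ℝ} (hp₀ : Continuous p₀) (x t : ℝ) :
    M.TermsWellDefined p₀ x t := by
  have hτ := continuous_travelTime hK hρ
  have hq : Continuous (M.signal p₀) := continuous_signal hp₀
  refine ⟨fun m => ⟨fun y _ => ?_, ?_⟩, fun k => ⟨fun y _ => ?_, ?_⟩⟩
  · rw [show M.innerR p₀ x t y = _ from funext (innerR_eq p₀ (even_two_mul m) x t y)]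
    exact intervalIntegrable_reflCoeff_mul hK hρ (by fun_prop) _ _
  · rw [show M.outerR p₀ x t = _ from funext (outerR_eq p₀ (even_two_mul m) x t)]
    exact integrableOn_outer hK hρ hq _ x t
  · rw [show M.innerT p₀ x t y = _ from funext (innerT_eq p₀ (odd_two_mul_add_one k) x t y)]
    exact intervalIntegrable_reflCoeff_mul hK hρ (by fun_prop) _ _
  · rw [show M.outerT p₀ x t = _ from funext (outerT_eq p₀ (odd_two_mul_add_one k) x t)]
    exact integrableOn_outer hK hρ hq _ x t

end AcousticMedium

/-! ### Two facts from calculus -/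

/-- A punctured-neighbourhood version of `hasDerivAt_of_hasDerivAt_of_ne`. -/
theorem hasDerivAt_of_eventually_hasDerivAt {f g : ℝ → ℝ} {x : ℝ}
    (h : ∀ᶠ y in 𝓝[≠] x, HasDerivAt f (g y) y) (hf : ContinuousAt f x) (hg : ContinuousAt g x) :
    HasDerivAt f (g x) x := by
  have hR : HasDerivWithinAt f (g x) (Ici x) x := by
    have h' : ∀ᶠ y in 𝓝[>] x, HasDerivAt f (g y) y :=
      h.filter_mono (nhdsWithin_mono x fun y hy => ne_of_gt hy)
    refine hasDerivWithinAt_Ici_of_tendsto_deriv (s := {y | HasDerivAt f (g y) y})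
      (fun y hy => hy.differentiableAt.differentiableWithinAt) hf.continuousWithinAt h' ?_
    exact (hg.tendsto.mono_left nhdsWithin_le_nhds).congr' (h'.mono fun y hy => hy.deriv.symm)
  have hL : HasDerivWithinAt f (g x) (Iic x) x := by
    have h' : ∀ᶠ y in 𝓝[<] x, HasDerivAt f (g y) y :=
      h.filter_mono (nhdsWithin_mono x fun y hy => ne_of_lt hy)
    refine hasDerivWithinAt_Iic_of_tendsto_deriv (s := {y | HasDerivAt f (g y) y})
      (fun y hy => hy.differentiableAt.differentiableWithinAt) hf.continuousWithinAt h' ?_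
    exact (hg.tendsto.mono_left nhdsWithin_le_nhds).congr' (h'.mono fun y hy => hy.deriv.symm)
  simpa [Iic_union_Ici] using hL.union hR

/-- A function of two real variables with continuous partial derivatives is continuously
differentiable. -/
theorem contDiffAt_one_of_partials {f f₁ f₂ : ℝ → ℝ → ℝ} {U : Set (ℝ × ℝ)} (hU : IsOpen U)
    (h₁ : ∀ z ∈ U, HasDerivAt (fun x => f x z.2) (f₁ z.1 z.2) z.1)
    (h₂ : ∀ z ∈ U, HasDerivAt (fun t => f z.1 t) (f₂ z.1 z.2) z.2)
    (c₁ : ContinuousOn (fun z : ℝ × ℝ => f₁ z.1 z.2) U)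
    (c₂ : ContinuousOn (fun z : ℝ × ℝ => f₂ z.1 z.2) U) {z : ℝ × ℝ} (hz : z ∈ U) :
    ContDiffAt ℝ 1 (fun z : ℝ × ℝ => f z.1 z.2) z := by
  have hs : Continuous fun c : ℝ => ContinuousLinearMap.toSpanSingleton ℝ c :=
    (ContinuousLinearMap.toSpanSingletonCLE (𝕜 := ℝ) (E := ℝ)).continuous
  have hc₁ : ContinuousOn (fun z : ℝ × ℝ => ContinuousLinearMap.toSpanSingleton ℝ (f₁ z.1 z.2)) U :=
    hs.comp_continuousOn c₁
  have hc₂ : ContinuousOn (fun z : ℝ × ℝ => ContinuousLinearMap.toSpanSingleton ℝ (f₂ z.1 z.2)) U :=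
    hs.comp_continuousOn c₂
  refine contDiffAt_one_iff.2 ⟨fun z => f₁ z.1 z.2 • ContinuousLinearMap.fst ℝ ℝ ℝ +
    f₂ z.1 z.2 • ContinuousLinearMap.snd ℝ ℝ ℝ, U, hU.mem_nhds hz, ?_, ?_⟩
  · exact (c₁.smul continuousOn_const).add (c₂.smul continuousOn_const)
  · intro w hw
    have := hasStrictFDerivAt_uncurry_coprod (𝕜 := ℝ) (u := w) (f := f)
      (f₁ := fun a t => ContinuousLinearMap.toSpanSingleton ℝ (f₁ a t))
      (f₂ := fun a t => ContinuousLinearMap.toSpanSingleton ℝ (f₂ a t))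
      (by filter_upwards [hU.mem_nhds hw] with v hv using (h₁ v hv).hasFDerivAt)
      (by filter_upwards [hU.mem_nhds hw] with v hv using (h₂ v hv).hasFDerivAt)
      (hc₁.continuousAt (hU.mem_nhds hw)) (hc₂.continuousAt (hU.mem_nhds hw))
    refine this.hasFDerivAt.congr_fderiv ?_
    ext <;> simp [Function.HasUncurry.uncurry]

namespace AcousticMedium

variable {M : AcousticMedium}

/-! ### The path sum solves the initial value problem -/

theorem hasDerivAt_signal {p₀ : ℝ → ℝ} (hp₀ : ContDiff ℝ 1 p₀) (t : ℝ) :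
    HasDerivAt (M.signal p₀) (-M.soundSpeedLeft * M.signal (deriv p₀) t) t := by
  have h1 : HasDerivAt (fun t => -M.soundSpeedLeft * t) (-M.soundSpeedLeft) t := by
    simpa using (hasDerivAt_id t).const_mul (-M.soundSpeedLeft)
  have h2 := (hp₀.differentiable one_ne_zero (-M.soundSpeedLeft * t)).hasDerivAt
  refine (HasDerivAt.comp t h2 h1).congr_deriv ?_
  rw [signal, mul_comm]

variable (M) in
/-- The time derivative of the incoming signal. -/
def signalDeriv (p₀ : ℝ → ℝ) (t : ℝ) : ℝ := -M.soundSpeedLeft * M.signal (deriv p₀) t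

theorem continuous_signalDeriv {p₀ : ℝ → ℝ} (hp₀ : ContDiff ℝ 1 p₀) :
    Continuous (M.signalDeriv p₀) :=
  continuous_const.mul (continuous_signal (hp₀.continuous_deriv le_rfl))

theorem signalDeriv_of_nonpos {p₀ : ℝ → ℝ} (hp₀ : ContDiff ℝ 1 p₀)
    (h : ∀ x, 0 ≤ x → p₀ x = 0) {t : ℝ} (ht : t ≤ 0) : M.signalDeriv p₀ t = 0 := by
  have hpos : ∀ x, 0 < x → deriv p₀ x = 0 := fun x hx => by
    have : p₀ =ᶠ[𝓝 x] fun _ => 0 := by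
      filter_upwards [Ioi_mem_nhds hx] with y hy using h y (le_of_lt hy)
    rw [this.deriv_eq, deriv_const]
  have hcl : IsClosed {x | deriv p₀ x = 0} :=
    isClosed_eq (hp₀.continuous_deriv le_rfl) continuous_const
  have := closure_minimal (s := Ioi (0 : ℝ)) (fun x hx => hpos x hx) hcl
  rw [closure_Ioi] at this
  rw [signalDeriv, signal_of_nonpos (fun x hx => this hx) ht, mul_zero]

variable (hK : ContDiffOn ℝ 1 M.K (Icc 0 M.xplus)) (hρ : ContDiffOn ℝ 1 M.ρ (Icc 0 M.xplus))

theorem tsum_wOne {p₀ : ℝ → ℝ} (hp₀ : Continuous p₀) (x t : ℝ) :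
    ∑' m, M.wOne p₀ m x t =
      M.greenFactor x * (M.scattering hK hρ).leftSum (M.signal p₀) x t := by
  simp_rw [wOne_eq hK hρ hp₀, tsum_mul_left, ScatteringData.leftSum]

theorem tsum_wTwo {p₀ : ℝ → ℝ} (hp₀ : Continuous p₀) (x t : ℝ) :
    ∑' m, M.wTwo p₀ m x t =
      M.greenFactor x * (M.scattering hK hρ).rightSum (M.signal p₀) x t := by
  simp_rw [wTwo_eq hK hρ hp₀, tsum_mul_left, ScatteringData.rightSum]

/-- The derivative of the projection to `[0, xplus]` times the continuous reflection coefficient is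
the reflection coefficient. -/
theorem exists_hasDerivAt_clampTo {x : ℝ} (h0 : x ≠ 0) (h1 : x ≠ M.xplus) :
    ∃ e, HasDerivAt (clampTo M.xplus) e x ∧ (e = 0 ∨ clampTo M.xplus x = x) ∧
      e * (M.scattering hK hρ).refl x = M.reflCoeff x := by
  rcases lt_or_gt_of_ne h0 with h0 | h0
  · exact ⟨0, hasDerivAt_clampTo_of_neg h0, Or.inl rfl, by rw [reflCoeff_of_neg h0, zero_mul]⟩
  rcases lt_or_gt_of_ne h1 with h1 | h1
  · exact ⟨1, hasDerivAt_clampTo_of_mem ⟨h0, h1⟩, Or.inr (clampTo_of_mem ⟨h0.le, h1.le⟩),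
      by rw [scattering_refl hK hρ ⟨h0, h1⟩, one_mul]⟩
  · exact ⟨0, hasDerivAt_clampTo_of_gt M.xplus_pos h1, Or.inl rfl,
      by rw [reflCoeff_of_gt h1, zero_mul]⟩

section Fields

variable (p₀ : ℝ → ℝ)

/-- The time derivative of the path-sum pressure. -/
def pressureRate (x t : ℝ) : ℝ :=
  M.greenFactor x * ((M.scattering hK hρ).leftSum (M.signalDeriv p₀) x t +
    (M.scattering hK hρ).rightSum (M.signalDeriv p₀) x t)

/-- The time derivative of the path-sum velocity. -/
def velocityRate (x t : ℝ) : ℝ :=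
  M.greenFactor x * ((M.scattering hK hρ).rightSum (M.signalDeriv p₀) x t -
    (M.scattering hK hρ).leftSum (M.signalDeriv p₀) x t) / M.impedance x

variable {p₀} (hp₀ : ContDiff ℝ 1 p₀) (hsupp : ∀ x, 0 ≤ x → p₀ x = 0)

include hK hρ in
theorem pBar_eq (hp₀ : Continuous p₀) (x t : ℝ) : M.pBar p₀ x t =
    M.greenFactor x * ((M.scattering hK hρ).leftSum (M.signal p₀) x t +
      (M.scattering hK hρ).rightSum (M.signal p₀) x t) := by
  rw [pBar, tsum_wOne hK hρ hp₀, tsum_wTwo hK hρ hp₀, mul_add]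

include hK hρ in
theorem uBar_eq (hp₀ : Continuous p₀) (x t : ℝ) : M.uBar p₀ x t =
    M.greenFactor x * ((M.scattering hK hρ).rightSum (M.signal p₀) x t -
      (M.scattering hK hρ).leftSum (M.signal p₀) x t) / M.impedance x := by
  rw [uBar, tsum_wOne hK hρ hp₀, tsum_wTwo hK hρ hp₀, mul_sub]

include hp₀ hsupp

include hK hρ in
theorem continuous_pBar : Continuous fun z : ℝ × ℝ => M.pBar p₀ z.1 z.2 := by
  simp_rw [pBar_eq hK hρ hp₀.continuous]
  have hq := continuous_signal (M := M) hp₀.continuous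
  have hq0 : ∀ t ≤ 0, M.signal p₀ t = 0 := fun t ht => signal_of_nonpos hsupp ht
  exact (M.continuous_greenFactor.comp continuous_fst).mul
    ((ScatteringData.continuous_leftSum _ hq hq0).add
      (ScatteringData.continuous_rightSum _ hq hq0))

include hK hρ in
theorem continuous_uBar : Continuous fun z : ℝ × ℝ => M.uBar p₀ z.1 z.2 := by
  simp_rw [uBar_eq hK hρ hp₀.continuous]
  have hq := continuous_signal (M := M) hp₀.continuous
  have hq0 : ∀ t ≤ 0, M.signal p₀ t = 0 := fun t ht => signal_of_nonpos hsupp ht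
  exact ((M.continuous_greenFactor.comp continuous_fst).mul
    ((ScatteringData.continuous_rightSum _ hq hq0).sub
      (ScatteringData.continuous_leftSum _ hq hq0))).div
      (M.continuous_impedance'.comp continuous_fst) fun z => (M.impedance_pos _).ne'

theorem continuous_pressureRate :
    Continuous fun z : ℝ × ℝ => pressureRate hK hρ p₀ z.1 z.2 := by
  have hq := continuous_signalDeriv (M := M) hp₀
  have hq0 : ∀ t ≤ 0, M.signalDeriv p₀ t = 0 := fun t ht => signalDeriv_of_nonpos hp₀ hsupp ht
  exact (M.continuous_greenFactor.comp continuous_fst).mul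
    ((ScatteringData.continuous_leftSum _ hq hq0).add
      (ScatteringData.continuous_rightSum _ hq hq0))

theorem continuous_velocityRate :
    Continuous fun z : ℝ × ℝ => velocityRate hK hρ p₀ z.1 z.2 := by
  have hq := continuous_signalDeriv (M := M) hp₀
  have hq0 : ∀ t ≤ 0, M.signalDeriv p₀ t = 0 := fun t ht => signalDeriv_of_nonpos hp₀ hsupp ht
  exact ((M.continuous_greenFactor.comp continuous_fst).mul
    ((ScatteringData.continuous_rightSum _ hq hq0).sub
      (ScatteringData.continuous_leftSum _ hq hq0))).div
      (M.continuous_impedance'.comp continuous_fst) fun z => (M.impedance_pos _).ne'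

theorem hasDerivAt_pBar_time (x t : ℝ) :
    HasDerivAt (fun t => M.pBar p₀ x t) (pressureRate hK hρ p₀ x t) t := by
  simp_rw [pBar_eq hK hρ hp₀.continuous]
  have hq := continuous_signal (M := M) hp₀.continuous
  have hq0 : ∀ t ≤ 0, M.signal p₀ t = 0 := fun t ht => signal_of_nonpos hsupp ht
  have hq' := continuous_signalDeriv (M := M) hp₀
  have hq0' : ∀ t ≤ 0, M.signalDeriv p₀ t = 0 := fun t ht => signalDeriv_of_nonpos hp₀ hsupp ht
  exact ((ScatteringData.hasDerivAt_leftSum _ hq hq0 hq' hq0' (hasDerivAt_signal hp₀) x t).add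
    (ScatteringData.hasDerivAt_rightSum _ hq hq0 hq' hq0' (hasDerivAt_signal hp₀) x t)).const_mul _

theorem hasDerivAt_uBar_time (x t : ℝ) :
    HasDerivAt (fun t => M.uBar p₀ x t) (velocityRate hK hρ p₀ x t) t := by
  simp_rw [uBar_eq hK hρ hp₀.continuous]
  have hq := continuous_signal (M := M) hp₀.continuous
  have hq0 : ∀ t ≤ 0, M.signal p₀ t = 0 := fun t ht => signal_of_nonpos hsupp ht
  have hq' := continuous_signalDeriv (M := M) hp₀
  have hq0' : ∀ t ≤ 0, M.signalDeriv p₀ t = 0 := fun t ht => signalDeriv_of_nonpos hp₀ hsupp ht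
  exact (((ScatteringData.hasDerivAt_rightSum _ hq hq0 hq' hq0' (hasDerivAt_signal hp₀) x t).sub
    (ScatteringData.hasDerivAt_leftSum _ hq hq0 hq' hq0'
      (hasDerivAt_signal hp₀) x t)).const_mul _).div_const _

/-- Off the interfaces the integral equations give the spatial derivatives. The terms that contain
the reflection coefficient cancel against the derivatives of `C_G` and `Z`. -/
theorem hasDerivAt_space_of_ne {x : ℝ} (h0 : x ≠ 0) (h1 : x ≠ M.xplus) (t : ℝ) :
    HasDerivAt (fun x => M.pBar p₀ x t) (-(M.ρ x * velocityRate hK hρ p₀ x t)) x ∧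
    HasDerivAt (fun x => M.uBar p₀ x t) (-(pressureRate hK hρ p₀ x t / M.K x)) x := by
  simp_rw [uBar_eq hK hρ hp₀.continuous, pBar_eq hK hρ hp₀.continuous]
  have hq := continuous_signal (M := M) hp₀.continuous
  have hq0 : ∀ t ≤ 0, M.signal p₀ t = 0 := fun t ht => signal_of_nonpos hsupp ht
  have hq' := continuous_signalDeriv (M := M) hp₀
  have hq0' : ∀ t ≤ 0, M.signalDeriv p₀ t = 0 := fun t ht => signalDeriv_of_nonpos hp₀ hsupp ht
  have hτ := hasDerivAt_travelTime hK hρ (mem_regularSet hK hρ h0 h1)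
  obtain ⟨e, he, hex, hr⟩ := exists_hasDerivAt_clampTo hK hρ h0 h1
  have hv1 := ScatteringData.hasDerivAt_leftSum_space (M.scattering hK hρ) (t := t) hq hq0 hq' hq0'
    (hasDerivAt_signal hp₀) hτ he hex
  have hv2 := ScatteringData.hasDerivAt_rightSum_space (M.scattering hK hρ) (t := t) hq hq0 hq'
    hq0' (hasDerivAt_signal hp₀) hτ he hex
  rw [hr] at hv1 hv2
  have hG := hasDerivAt_greenFactor hK hρ h0 h1
  have hZ := hasDerivAt_impedance hK hρ h0 h1
  have hZ0 := (M.impedance_pos x).ne'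
  have hc0 := (M.soundSpeed_pos x).ne'
  constructor
  · refine (hG.mul (hv1.add hv2)).congr_deriv ?_
    rw [← impedance_div_soundSpeed, velocityRate]
    simp only [Pi.add_apply]
    field_simp
    ring
  · refine ((hG.mul (hv2.sub hv1)).div hZ hZ0).congr_deriv ?_
    rw [← impedance_mul_soundSpeed, pressureRate]
    simp only [Pi.sub_apply, Pi.mul_apply]
    field_simp
    ring

/-- At an interface where `K` and `ρ` are continuous, the reflection coefficient may still jump, but
the right-hand sides of the equations are continuous, and so the derivatives extend. -/
theorem hasDerivAt_space {x : ℝ} (hx : x ∈ M.regularSet) (t : ℝ) :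
    HasDerivAt (fun x => M.pBar p₀ x t) (-(M.ρ x * velocityRate hK hρ p₀ x t)) x ∧
    HasDerivAt (fun x => M.uBar p₀ x t) (-(pressureRate hK hρ p₀ x t / M.K x)) x := by
  have hne : ∀ᶠ y in 𝓝[≠] x, y ≠ 0 ∧ y ≠ M.xplus := by
    have : ∀ a : ℝ, ∀ᶠ y in 𝓝[≠] x, y ≠ a := fun a => by
      rcases eq_or_ne x a with rfl | h
      · exact eventually_mem_nhdsWithin
      · exact eventually_nhdsWithin_of_eventually_nhds (isOpen_ne.mem_nhds h)
    exact (this 0).and (this M.xplus)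
  have hcx : ∀ {f : ℝ → ℝ → ℝ}, Continuous (fun z : ℝ × ℝ => f z.1 z.2) →
      ContinuousAt (fun x => f x t) x :=
    fun hf => (hf.comp (f := fun x : ℝ => (x, t)) (by fun_prop)).continuousAt
  constructor
  · exact hasDerivAt_of_eventually_hasDerivAt
      (hne.mono fun y hy => (hasDerivAt_space_of_ne hK hρ hp₀ hsupp hy.1 hy.2 t).1)
      (hcx (continuous_pBar hK hρ hp₀ hsupp))
      (hx.2.mul (hcx (continuous_velocityRate hK hρ hp₀ hsupp))).neg
  · exact hasDerivAt_of_eventually_hasDerivAt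
      (hne.mono fun y hy => (hasDerivAt_space_of_ne hK hρ hp₀ hsupp hy.1 hy.2 t).2)
      (hcx (continuous_uBar hK hρ hp₀ hsupp))
      ((hcx (continuous_pressureRate hK hρ hp₀ hsupp)).div hx.1 (M.K_pos x).ne').neg

include hK hρ in
theorem isSolution_pBar_uBar : M.IsSolution p₀ (M.pBar p₀) (M.uBar p₀) := by
  have hq0 : ∀ t ≤ 0, M.signal p₀ t = 0 := fun t ht => signal_of_nonpos hsupp ht
  have hq := continuous_signal (M := M) hp₀.continuous
  have hopen := isOpen_regularSet hK hρ
  have hU : IsOpen (M.regularSet ×ˢ (univ : Set ℝ)) := hopen.prod isOpen_univ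
  have hKc : ContinuousOn (fun z : ℝ × ℝ => M.K z.1) (M.regularSet ×ˢ (univ : Set ℝ)) :=
    (show ContinuousOn M.K M.regularSet from fun x hx => hx.1.continuousWithinAt).comp
      continuousOn_fst fun z hz => hz.1
  have hρc : ContinuousOn (fun z : ℝ × ℝ => M.ρ z.1) (M.regularSet ×ˢ (univ : Set ℝ)) :=
    (show ContinuousOn M.ρ M.regularSet from fun x hx => hx.2.continuousWithinAt).comp
      continuousOn_fst fun z hz => hz.1
  refine ⟨(continuous_pBar hK hρ hp₀ hsupp).continuousOn,
    (continuous_uBar hK hρ hp₀ hsupp).continuousOn, fun x hx => ?_, fun x hx => ?_,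
    fun x t _ h1 h2 => ⟨?_, ?_⟩, fun x t _ h1 h2 => ?_, fun x t _ h1 h2 => ?_⟩
  · rw [uBar_eq hK hρ hp₀.continuous, pBar_eq hK hρ hp₀.continuous,
      ScatteringData.leftSum_zero _ hq0, ScatteringData.rightSum_zero _ hq hq0,
      greenFactor_of_nonpos hx.le, M.impedance_of_nonpos hx.le]
    have : M.signal p₀ (-(M.scattering hK hρ).time x) = p₀ x := by
      change p₀ (-M.soundSpeedLeft * -M.travelTime x) = _
      rw [travelTime_of_nonpos hx.le]
      have := M.soundSpeedLeft_pos.ne'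
      congr 1; field_simp
    simp [this]
  · have : M.signal p₀ (-(M.scattering hK hρ).time x) = 0 := by
      refine hq0 _ (neg_nonpos.2 ?_)
      have := (M.scattering hK hρ).monotone_time hx
      rwa [ScatteringData.time_zero] at this
    rw [uBar_eq hK hρ hp₀.continuous, pBar_eq hK hρ hp₀.continuous,
      ScatteringData.leftSum_zero _ hq0, ScatteringData.rightSum_zero _ hq hq0, this]
    simp
  · exact contDiffAt_one_of_partials (f₁ := fun x t => -(M.ρ x * velocityRate hK hρ p₀ x t)) hU
      (fun z hz => (hasDerivAt_space hK hρ hp₀ hsupp hz.1 z.2).1)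
      (fun z _ => hasDerivAt_pBar_time hK hρ hp₀ hsupp z.1 z.2)
      (hρc.mul (continuous_velocityRate hK hρ hp₀ hsupp).continuousOn).neg
      (continuous_pressureRate hK hρ hp₀ hsupp).continuousOn ⟨⟨h1, h2⟩, mem_univ _⟩
  · exact contDiffAt_one_of_partials (f₁ := fun x t => -(pressureRate hK hρ p₀ x t / M.K x)) hU
      (fun z hz => (hasDerivAt_space hK hρ hp₀ hsupp hz.1 z.2).2)
      (fun z _ => hasDerivAt_uBar_time hK hρ hp₀ hsupp z.1 z.2)
      ((continuous_pressureRate hK hρ hp₀ hsupp).continuousOn.div hKc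
        fun z _ => (M.K_pos _).ne').neg
      (continuous_velocityRate hK hρ hp₀ hsupp).continuousOn ⟨⟨h1, h2⟩, mem_univ _⟩
  · rw [(hasDerivAt_pBar_time hK hρ hp₀ hsupp x t).deriv,
      (hasDerivAt_space hK hρ hp₀ hsupp ⟨h1, h2⟩ t).2.deriv]
    have := (M.K_pos x).ne'
    field_simp; ring
  · rw [(hasDerivAt_uBar_time hK hρ hp₀ hsupp x t).deriv,
      (hasDerivAt_space hK hρ hp₀ hsupp ⟨h1, h2⟩ t).1.deriv]
    have := (M.ρ_pos x).ne'
    field_simp; ring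

end Fields

end AcousticMedium

/-! ### Uniqueness for the integral equations -/

namespace ScatteringData

variable (D : ScatteringData)

/-- The reflection coefficient, set to zero outside the scattering region. -/
def reflInside : ℝ → ℝ := (Ioo 0 D.len).indicator D.refl

theorem measurable_reflInside : Measurable D.reflInside :=
  D.continuous_refl.measurable.indicator measurableSet_Ioo

theorem abs_reflInside_le (s : ℝ) : |D.reflInside s| ≤ D.bnd := by
  unfold reflInside
  by_cases h : s ∈ Ioo 0 D.len
  · rw [indicator_of_mem h]; exact D.abs_refl_le s
  · rw [indicator_of_notMem h, abs_zero]; exact D.bnd_pos.le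

theorem intervalIntegrable_reflInside_mul {g : ℝ → ℝ} {a b : ℝ} (hg : ContinuousOn g (uIcc a b)) :
    IntervalIntegrable (fun s => D.reflInside s * g s) volume a b := by
  have h : IntervalIntegrable D.reflInside volume a b := by
    refine (intervalIntegrable_const (c := D.bnd)).mono_fun
      D.measurable_reflInside.aestronglyMeasurable.restrict (Eventually.of_forall fun s => ?_)
    exact (D.abs_reflInside_le s).trans (le_abs_self _)
  exact h.mul_continuousOn hg

theorem exists_le_time_eq (x : ℝ) {t : ℝ} (ht : 0 ≤ t) :
    ∃ a ≤ x, D.time a = D.time x - t := by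
  have hs := D.slow_pos
  have hle : x - t / D.slow ≤ x := by have := div_nonneg ht hs.le; linarith
  have h := D.slow_mul_le _ _ hle
  rw [sub_sub_cancel, mul_div_cancel₀ _ hs.ne'] at h
  obtain ⟨a, ha, hτ⟩ := intermediate_value_Icc hle D.continuous_time.continuousOn
    (show D.time x - t ∈ Icc _ _ from ⟨by linarith, by linarith⟩)
  exact ⟨a, ha.2, hτ⟩

theorem exists_ge_time_eq (x : ℝ) {t : ℝ} (ht : 0 ≤ t) :
    ∃ b ≥ x, D.time b = D.time x + t := by
  have hs := D.slow_pos
  have hle : x ≤ x + t / D.slow := by have := div_nonneg ht hs.le; linarith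
  have h := D.slow_mul_le _ _ hle
  rw [add_sub_cancel_left, mul_div_cancel₀ _ hs.ne'] at h
  obtain ⟨b, hb, hτ⟩ := intermediate_value_Icc hle D.continuous_time.continuousOn
    (show D.time x + t ∈ Icc _ _ from ⟨by linarith, by linarith⟩)
  exact ⟨b, hb.1, hτ⟩

/-- A domain of dependence: with each of its points it contains the backward characteristics. -/
def cone (L : ℝ) : Set (ℝ × ℝ) := {z | 0 ≤ z.2 ∧ |D.time z.1| + z.2 ≤ L}

theorem isCompact_cone (L : ℝ) : IsCompact (D.cone L) := by
  have hτ := D.continuous_time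
  have hsum : Continuous fun z : ℝ × ℝ => |D.time z.1| + z.2 := by fun_prop
  have hcl : IsClosed (D.cone L) :=
    (isClosed_le continuous_const continuous_snd).inter (isClosed_le hsum continuous_const)
  refine ((isCompact_Icc (a := -(L / D.slow)) (b := L / D.slow)).prod
    (isCompact_Icc (a := (0 : ℝ)) (b := L))).of_isClosed_subset hcl fun z hz => ?_
  -- The slope bound on the travel time makes the cone bounded in space.
  have h1 : |z.1| * D.slow ≤ |D.time z.1| := by
    rcases le_total 0 z.1 with h | h
    · have := D.slow_mul_le _ _ h
      rw [D.time_zero] at this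
      rw [abs_of_nonneg h]
      exact le_trans (by linarith) (le_abs_self _)
    · have := D.slow_mul_le _ _ h
      rw [D.time_zero] at this
      rw [abs_of_nonpos h]
      exact le_trans (by linarith) (neg_le_abs _)
  have h2 : |z.1| ≤ L / D.slow := by
    rw [le_div_iff₀ D.slow_pos]
    linarith [hz.1, hz.2]
  exact ⟨abs_le.1 h2, hz.1, by linarith [hz.2, abs_nonneg (D.time z.1)]⟩

theorem abs_reflInside_mul_le {s y B t T : ℝ} (hB : 0 ≤ B)
    (hy : |y| ≤ B * Real.exp (D.rate * t)) (ht : t ≤ T) :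
    |D.reflInside s * y| ≤ D.bnd * (B * Real.exp (D.rate * T)) := by
  rw [abs_mul]
  refine mul_le_mul (D.abs_reflInside_le s) (hy.trans ?_) (abs_nonneg _) D.bnd_pos.le
  have := D.rate_pos
  gcongr

/-- The homogeneous integral equations have only the zero solution: each application of the
equations halves the bound in the exponentially weighted norm on a domain of dependence. -/
theorem eq_zero_of_homogeneous {d₁ d₂ : ℝ → ℝ → ℝ}
    (hc₁ : ContinuousOn (fun z : ℝ × ℝ => d₁ z.1 z.2) (univ ×ˢ Ici 0))
    (hc₂ : ContinuousOn (fun z : ℝ × ℝ => d₂ z.1 z.2) (univ ×ˢ Ici 0))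
    (h₁ : ∀ x t b, 0 ≤ t → x ≤ b → D.time b = D.time x + t →
      d₁ x t = ∫ s in x..b, D.reflInside s * d₂ s (t + D.time x - D.time s))
    (h₂ : ∀ x t a, 0 ≤ t → a ≤ x → D.time a = D.time x - t →
      d₂ x t = -∫ s in a..x, D.reflInside s * d₁ s (t - D.time x + D.time s))
    (x t : ℝ) (ht : 0 ≤ t) : d₁ x t = 0 ∧ d₂ x t = 0 := by
  -- The smallest domain of dependence that contains `(x, t)`.
  set L := |D.time x| + t
  have hsub : D.cone L ⊆ univ ×ˢ Ici 0 := fun z hz => ⟨mem_univ _, hz.1⟩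
  obtain ⟨B₁, hB₁⟩ := (D.isCompact_cone L).exists_bound_of_continuousOn (hc₁.mono hsub)
  obtain ⟨B₂, hB₂⟩ := (D.isCompact_cone L).exists_bound_of_continuousOn (hc₂.mono hsub)
  set B := max (max B₁ B₂) 0
  have hB : 0 ≤ B := le_max_right _ _
  have hrate := D.rate_pos
  have key : ∀ n : ℕ, ∀ z ∈ D.cone L,
      |d₁ z.1 z.2| ≤ B * (1 / 2) ^ n * Real.exp (D.rate * z.2) ∧
      |d₂ z.1 z.2| ≤ B * (1 / 2) ^ n * Real.exp (D.rate * z.2) := by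
    intro n
    induction n with
    | zero =>
      intro z hz
      have he : B ≤ B * Real.exp (D.rate * z.2) :=
        le_mul_of_one_le_right hB (Real.one_le_exp (mul_nonneg hrate.le hz.1))
      rw [pow_zero, mul_one]
      exact ⟨((hB₁ z hz).trans ((le_max_left _ _).trans (le_max_left _ _))).trans he,
        ((hB₂ z hz).trans ((le_max_right _ _).trans (le_max_left _ _))).trans he⟩
    | succ n ih =>
      rintro ⟨y, s⟩ ⟨hs, hL⟩
      simp only at hs hL
      have hBn : 0 ≤ B * (1 / 2) ^ n := by positivity
      rw [show B * (1 / 2) ^ (n + 1) = B * (1 / 2) ^ n / 2 by rw [pow_succ]; ring]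
      constructor
      · obtain ⟨b, hb, hτ⟩ := D.exists_ge_time_eq y hs
        simp only
        rw [h₁ y s b hs hb hτ]
        refine D.abs_integral_le_of_exp_left hb hBn fun w hw => ?_
        have m1 := D.monotone_time hw.1
        have m2 := D.monotone_time hw.2
        have m3 := D.slow_mul_le _ _ hw.1
        have m4 : |D.time w| ≤ |D.time y| + (D.time w - D.time y) := by
          have := abs_add_le (D.time y) (D.time w - D.time y)
          rwa [add_sub_cancel, abs_of_nonneg (sub_nonneg.2 m1)] at this
        exact D.abs_reflInside_mul_le hBn
          (ih (w, s + D.time y - D.time w)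
            ⟨by simp only; linarith, by simp only; linarith⟩).2 (by simp only; linarith)
      · obtain ⟨a, ha, hτ⟩ := D.exists_le_time_eq y hs
        simp only
        rw [h₂ y s a hs ha hτ, abs_neg]
        refine D.abs_integral_le_of_exp_right ha hBn fun w hw => ?_
        have m1 := D.monotone_time hw.1
        have m2 := D.monotone_time hw.2
        have m3 := D.slow_mul_le _ _ hw.2
        have m4 : |D.time w| ≤ |D.time y| + (D.time y - D.time w) := by
          have := abs_sub (D.time y) (D.time y - D.time w)
          rwa [sub_sub_cancel, abs_of_nonneg (sub_nonneg.2 m2)] at this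
        exact D.abs_reflInside_mul_le hBn
          (ih (w, s - D.time y + D.time w)
            ⟨by simp only; linarith, by simp only; linarith⟩).1 (by simp only; linarith)
  have hlim : Tendsto (fun n : ℕ => B * (1 / 2 : ℝ) ^ n * Real.exp (D.rate * t)) atTop (𝓝 0) := by
    have := tendsto_pow_atTop_nhds_zero_of_lt_one (r := (1 / 2 : ℝ)) (by norm_num) (by norm_num)
    simpa using (this.const_mul B).mul_const (Real.exp (D.rate * t))
  have hmem : (x, t) ∈ D.cone L := ⟨ht, le_rfl⟩
  exact ⟨abs_nonpos_iff.1 (ge_of_tendsto' hlim fun n => (key n _ hmem).1),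
    abs_nonpos_iff.1 (ge_of_tendsto' hlim fun n => (key n _ hmem).2)⟩

end ScatteringData

/-! ### Solutions along the characteristics -/

namespace AcousticMedium

variable {M : AcousticMedium} (hK : ContDiffOn ℝ 1 M.K (Icc 0 M.xplus))
  (hρ : ContDiffOn ℝ 1 M.ρ (Icc 0 M.xplus))

variable (M) in
/-- The left-going Riemann invariant of a pair `(p, u)`, divided by Green's amplification factor. -/
def leftInvariant (p u : ℝ → ℝ → ℝ) (x t : ℝ) : ℝ :=
  (p x t - M.impedance x * u x t) / (2 * M.greenFactor x)

variable (M) in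
/-- The right-going Riemann invariant of a pair `(p, u)`, divided by Green's amplification
factor. -/
def rightInvariant (p u : ℝ → ℝ → ℝ) (x t : ℝ) : ℝ :=
  (p x t + M.impedance x * u x t) / (2 * M.greenFactor x)

theorem reflInside_eq {s : ℝ} (h0 : s ≠ 0) (h1 : s ≠ M.xplus) :
    (M.scattering hK hρ).reflInside s = M.reflCoeff s := by
  change (Ioo 0 M.xplus).indicator _ s = _
  rcases lt_or_gt_of_ne h0 with h0 | h0
  · rw [indicator_of_notMem (fun h => absurd h.1 (not_lt.2 h0.le)), reflCoeff_of_neg h0]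
  rcases lt_or_gt_of_ne h1 with h1 | h1
  · rw [indicator_of_mem (show s ∈ Ioo 0 M.xplus from ⟨h0, h1⟩), scattering_refl hK hρ ⟨h0, h1⟩]
  · rw [indicator_of_notMem (fun h => absurd h.2 (not_lt.2 h1.le)), reflCoeff_of_gt h1]

/-- The derivative along a curve, in terms of the partial derivatives. -/
theorem hasDerivAt_along {f : ℝ → ℝ → ℝ} {γ : ℝ → ℝ} {k s : ℝ}
    (hf : ContDiffAt ℝ 1 (fun z : ℝ × ℝ => f z.1 z.2) (s, γ s)) (hγ : HasDerivAt γ k s) :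
    HasDerivAt (fun s => f s (γ s))
      (deriv (fun y => f y (γ s)) s + k * deriv (fun t => f s t) (γ s)) s := by
  have hd := (hf.differentiableAt one_ne_zero).hasFDerivAt
  set A := fderiv ℝ (fun z : ℝ × ℝ => f z.1 z.2) (s, γ s)
  have h1 : HasDerivAt (fun y => f y (γ s)) (A (1, 0)) s :=
    HasFDerivAt.comp_hasDerivAt (f := fun y : ℝ => (y, γ s)) s hd
      ((hasDerivAt_id s).prodMk (hasDerivAt_const s (γ s)))
  have h2 : HasDerivAt (fun t => f s t) (A (0, 1)) (γ s) :=
    HasFDerivAt.comp_hasDerivAt (f := fun t : ℝ => (s, t)) (γ s) hd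
      ((hasDerivAt_const (γ s) s).prodMk (hasDerivAt_id (γ s)))
  have h3 : HasDerivAt (fun y => f y (γ y)) (A (1, k)) s :=
    HasFDerivAt.comp_hasDerivAt (f := fun y : ℝ => (y, γ y)) s hd ((hasDerivAt_id s).prodMk hγ)
  rw [h1.deriv, h2.deriv]
  refine h3.congr_deriv ?_
  have : ((1, k) : ℝ × ℝ) = (1, 0) + k • (0, 1) := by simp
  rw [this, map_add, map_smul, smul_eq_mul]

section Solution

variable {p₀ : ℝ → ℝ} {p u : ℝ → ℝ → ℝ} (hs : M.IsSolution p₀ p u)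
include hK hρ hs

/-- Along a right-going characteristic the equations combine to `p' + Z u' = 0`, so that only
derivatives of the coefficients remain. -/
theorem IsSolution.hasDerivAt_rightInvariant {t₀ s : ℝ} (h0 : s ≠ 0) (h1 : s ≠ M.xplus)
    (ht : 0 < t₀ + M.travelTime s) :
    HasDerivAt (fun s => M.rightInvariant p u s (t₀ + M.travelTime s))
      (-(M.reflCoeff s * M.leftInvariant p u s (t₀ + M.travelTime s))) s := by
  have hreg := mem_regularSet hK hρ h0 h1
  have hτ := (hasDerivAt_travelTime hK hρ hreg).const_add t₀
  obtain ⟨cp, cu⟩ := hs.contDiffAt s _ ht hreg.1 hreg.2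
  have dp := hasDerivAt_along (γ := fun s => t₀ + M.travelTime s) cp hτ
  have du := hasDerivAt_along (γ := fun s => t₀ + M.travelTime s) cu hτ
  have e1 := hs.pressure_eq s _ ht hreg.1 hreg.2
  have e2 := hs.velocity_eq s _ ht hreg.1 hreg.2
  have hG := hasDerivAt_greenFactor hK hρ h0 h1
  have hZ := hasDerivAt_impedance hK hρ h0 h1
  have hZ0 := (M.impedance_pos s).ne'
  have hc0 := (M.soundSpeed_pos s).ne'
  have hG0 := (M.greenFactor_pos s).ne'
  refine ((dp.add (hZ.mul du)).div (hG.const_mul 2) (by positivity)).congr_deriv ?_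
  rw [← impedance_mul_soundSpeed] at e1
  rw [← impedance_div_soundSpeed] at e2
  simp only [Pi.add_apply, Pi.mul_apply, leftInvariant]
  set pt := deriv (fun t => p s t) (t₀ + M.travelTime s)
  set ut := deriv (fun t => u s t) (t₀ + M.travelTime s)
  set px := deriv (fun y => p y (t₀ + M.travelTime s)) s
  set ux := deriv (fun y => u y (t₀ + M.travelTime s)) s
  have e1' : pt = -(M.impedance s * M.soundSpeed s * ux) := by linarith
  have e2' : ut = -(px * M.soundSpeed s / M.impedance s) := by
    have : 1 / (M.impedance s / M.soundSpeed s) * px = px * M.soundSpeed s / M.impedance s := by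
      field_simp
    linarith
  rw [e1', e2']
  field_simp
  ring

/-- Along a left-going characteristic the equations combine to `p' - Z u' = 0`. -/
theorem IsSolution.hasDerivAt_leftInvariant {t₀ s : ℝ} (h0 : s ≠ 0) (h1 : s ≠ M.xplus)
    (ht : 0 < t₀ - M.travelTime s) :
    HasDerivAt (fun s => M.leftInvariant p u s (t₀ - M.travelTime s))
      (-(M.reflCoeff s * M.rightInvariant p u s (t₀ - M.travelTime s))) s := by
  have hreg := mem_regularSet hK hρ h0 h1
  have hτ := (hasDerivAt_travelTime hK hρ hreg).const_sub t₀
  obtain ⟨cp, cu⟩ := hs.contDiffAt s _ ht hreg.1 hreg.2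
  have dp := hasDerivAt_along (γ := fun s => t₀ - M.travelTime s) cp hτ
  have du := hasDerivAt_along (γ := fun s => t₀ - M.travelTime s) cu hτ
  have e1 := hs.pressure_eq s _ ht hreg.1 hreg.2
  have e2 := hs.velocity_eq s _ ht hreg.1 hreg.2
  have hG := hasDerivAt_greenFactor hK hρ h0 h1
  have hZ := hasDerivAt_impedance hK hρ h0 h1
  have hZ0 := (M.impedance_pos s).ne'
  have hc0 := (M.soundSpeed_pos s).ne'
  have hG0 := (M.greenFactor_pos s).ne'
  refine ((dp.sub (hZ.mul du)).div (hG.const_mul 2) (by positivity)).congr_deriv ?_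
  rw [← impedance_mul_soundSpeed] at e1
  rw [← impedance_div_soundSpeed] at e2
  simp only [Pi.sub_apply, Pi.mul_apply, rightInvariant]
  set pt := deriv (fun t => p s t) (t₀ - M.travelTime s)
  set ut := deriv (fun t => u s t) (t₀ - M.travelTime s)
  set px := deriv (fun y => p y (t₀ - M.travelTime s)) s
  set ux := deriv (fun y => u y (t₀ - M.travelTime s)) s
  have e1' : pt = -(M.impedance s * M.soundSpeed s * ux) := by linarith
  have e2' : ut = -(px * M.soundSpeed s / M.impedance s) := by
    have : 1 / (M.impedance s / M.soundSpeed s) * px = px * M.soundSpeed s / M.impedance s := by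
      field_simp
    linarith
  rw [e1', e2']
  field_simp
  ring

omit hK hρ in
theorem IsSolution.continuousOn_leftInvariant :
    ContinuousOn (fun z : ℝ × ℝ => M.leftInvariant p u z.1 z.2) (univ ×ˢ Ici 0) :=
  (hs.continuousOn_p.sub ((M.continuous_impedance'.comp continuous_fst).continuousOn.mul
    hs.continuousOn_u)).div
    (continuous_const.mul (M.continuous_greenFactor.comp continuous_fst)).continuousOn
    fun _ _ => (mul_pos two_pos (M.greenFactor_pos _)).ne'

omit hK hρ in
theorem IsSolution.continuousOn_rightInvariant :
    ContinuousOn (fun z : ℝ × ℝ => M.rightInvariant p u z.1 z.2) (univ ×ˢ Ici 0) :=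
  (hs.continuousOn_p.add ((M.continuous_impedance'.comp continuous_fst).continuousOn.mul
    hs.continuousOn_u)).div
    (continuous_const.mul (M.continuous_greenFactor.comp continuous_fst)).continuousOn
    fun _ _ => (mul_pos two_pos (M.greenFactor_pos _)).ne'

omit hs in
theorem travelTime_lt {a b : ℝ} (h : a < b) : M.travelTime a < M.travelTime b := by
  have h1 := (M.scattering hK hρ).slow_mul_le a b h.le
  have h2 := mul_pos (M.scattering hK hρ).slow_pos (sub_pos.2 h)
  change _ ≤ M.travelTime b - M.travelTime a at h1
  linarith

omit hs in
theorem mapsTo_leftCharacteristic {x t b : ℝ} (hxb : x ≤ b)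
    (hτ : M.travelTime b = M.travelTime x + t) :
    MapsTo (fun s => (s, t + M.travelTime x - M.travelTime s)) (uIcc x b)
      (univ ×ˢ Ici (0 : ℝ)) := fun s hs => by
  rw [uIcc_of_le hxb] at hs
  have : M.travelTime s ≤ M.travelTime b := (M.scattering hK hρ).monotone_time hs.2
  exact ⟨mem_univ _, by simp only [mem_Ici]; linarith⟩

omit hs in
theorem mapsTo_rightCharacteristic {x t a : ℝ} (hax : a ≤ x)
    (hτ : M.travelTime a = M.travelTime x - t) :
    MapsTo (fun s => (s, t - M.travelTime x + M.travelTime s)) (uIcc a x)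
      (univ ×ˢ Ici (0 : ℝ)) := fun s hs => by
  rw [uIcc_of_le hax] at hs
  have : M.travelTime a ≤ M.travelTime s := (M.scattering hK hρ).monotone_time hs.1
  exact ⟨mem_univ _, by simp only [mem_Ici]; linarith⟩

omit hs in
theorem continuousOn_along_left {f : ℝ → ℝ → ℝ}
    (hf : ContinuousOn (fun z : ℝ × ℝ => f z.1 z.2) (univ ×ˢ Ici 0)) {x t b : ℝ} (hxb : x ≤ b)
    (hτ : M.travelTime b = M.travelTime x + t) :
    ContinuousOn (fun s => f s (t + M.travelTime x - M.travelTime s)) (uIcc x b) := by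
  have hτc := continuous_travelTime hK hρ
  exact hf.comp (f := fun s : ℝ => (s, t + M.travelTime x - M.travelTime s))
    (Continuous.continuousOn (by fun_prop)) (mapsTo_leftCharacteristic hK hρ hxb hτ)

omit hs in
theorem continuousOn_along_right {f : ℝ → ℝ → ℝ}
    (hf : ContinuousOn (fun z : ℝ × ℝ => f z.1 z.2) (univ ×ˢ Ici 0)) {x t a : ℝ} (hax : a ≤ x)
    (hτ : M.travelTime a = M.travelTime x - t) :
    ContinuousOn (fun s => f s (t - M.travelTime x + M.travelTime s)) (uIcc a x) := by
  have hτc := continuous_travelTime hK hρ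
  exact hf.comp (f := fun s : ℝ => (s, t - M.travelTime x + M.travelTime s))
    (Continuous.continuousOn (by fun_prop)) (mapsTo_rightCharacteristic hK hρ hax hτ)

/-- The integral equation for the right-going invariant, down to the initial time. The
fundamental theorem of calculus tolerates the two interfaces and the initial time, where the
invariant is only continuous. -/
theorem IsSolution.rightInvariant_eq {x t a : ℝ} (hax : a ≤ x)
    (hτ : M.travelTime a = M.travelTime x - t) :
    M.rightInvariant p u x t = M.rightInvariant p u a 0 -
      ∫ s in a..x, (M.scattering hK hρ).reflInside s *
        M.leftInvariant p u s (t - M.travelTime x + M.travelTime s) := by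
  have hr := continuousOn_along_right hK hρ hs.continuousOn_rightInvariant hax hτ
  have hl := continuousOn_along_right hK hρ hs.continuousOn_leftInvariant hax hτ
  have h := integral_eq_of_hasDerivAt_off_countable
    (fun s => M.rightInvariant p u s (t - M.travelTime x + M.travelTime s))
    (fun s => -((M.scattering hK hρ).reflInside s *
      M.leftInvariant p u s (t - M.travelTime x + M.travelTime s)))
    (Set.toFinite {0, M.xplus}).countable hr (fun s hs' => ?_)
    ((M.scattering hK hρ).intervalIntegrable_reflInside_mul hl).neg
  · rw [intervalIntegral.integral_neg] at h
    simp only [sub_add_cancel] at h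
    rw [hτ, show t - M.travelTime x + (M.travelTime x - t) = 0 by ring] at h
    linarith
  · obtain ⟨hs1, hs2⟩ := hs'
    simp only [mem_insert_iff, mem_singleton_iff, not_or] at hs2
    rw [min_eq_left hax, max_eq_right hax] at hs1
    have := travelTime_lt hK hρ hs1.1
    rw [reflInside_eq hK hρ hs2.1 hs2.2]
    exact hs.hasDerivAt_rightInvariant hK hρ hs2.1 hs2.2 (by linarith)

/-- The integral equation for the left-going invariant, down to the initial time. -/
theorem IsSolution.leftInvariant_eq {x t b : ℝ} (hxb : x ≤ b)
    (hτ : M.travelTime b = M.travelTime x + t) :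
    M.leftInvariant p u x t = M.leftInvariant p u b 0 +
      ∫ s in x..b, (M.scattering hK hρ).reflInside s *
        M.rightInvariant p u s (t + M.travelTime x - M.travelTime s) := by
  have hr := continuousOn_along_left hK hρ hs.continuousOn_rightInvariant hxb hτ
  have hl := continuousOn_along_left hK hρ hs.continuousOn_leftInvariant hxb hτ
  have h := integral_eq_of_hasDerivAt_off_countable
    (fun s => M.leftInvariant p u s (t + M.travelTime x - M.travelTime s))
    (fun s => -((M.scattering hK hρ).reflInside s *
      M.rightInvariant p u s (t + M.travelTime x - M.travelTime s)))
    (Set.toFinite {0, M.xplus}).countable hl (fun s hs' => ?_)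
    ((M.scattering hK hρ).intervalIntegrable_reflInside_mul hr).neg
  · rw [intervalIntegral.integral_neg] at h
    simp only [add_sub_cancel_right] at h
    rw [hτ, show t + M.travelTime x - (M.travelTime x + t) = 0 by ring] at h
    linarith
  · obtain ⟨hs1, hs2⟩ := hs'
    simp only [mem_insert_iff, mem_singleton_iff, not_or] at hs2
    rw [min_eq_left hxb, max_eq_right hxb] at hs1
    have := travelTime_lt hK hρ hs1.2
    rw [reflInside_eq hK hρ hs2.1 hs2.2]
    exact hs.hasDerivAt_leftInvariant hK hρ hs2.1 hs2.2 (by linarith)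

/-- Two solutions with the same data agree, since the differences of their invariants satisfy the
homogeneous integral equations. -/
theorem IsSolution.eq_of_isSolution {p' u' : ℝ → ℝ → ℝ} (hs' : M.IsSolution p₀ p' u')
    {x t : ℝ} (ht : 0 ≤ t) : p x t = p' x t ∧ u x t = u' x t := by
  have hinit : ∀ y, p y 0 = p' y 0 ∧ u y 0 = u' y 0 := fun y => by
    rcases lt_or_ge y 0 with hy | hy
    · rw [(hs.initial_neg y hy).1, (hs.initial_neg y hy).2, (hs'.initial_neg y hy).1,
        (hs'.initial_neg y hy).2]
      exact ⟨rfl, rfl⟩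
    · rw [(hs.initial_nonneg y hy).1, (hs.initial_nonneg y hy).2, (hs'.initial_nonneg y hy).1,
        (hs'.initial_nonneg y hy).2]
      exact ⟨rfl, rfl⟩
  obtain ⟨z1, z2⟩ := (M.scattering hK hρ).eq_zero_of_homogeneous
    (d₁ := fun x t => M.leftInvariant p u x t - M.leftInvariant p' u' x t)
    (d₂ := fun x t => M.rightInvariant p u x t - M.rightInvariant p' u' x t)
    (hs.continuousOn_leftInvariant.sub hs'.continuousOn_leftInvariant)
    (hs.continuousOn_rightInvariant.sub hs'.continuousOn_rightInvariant)
    (fun x t b ht hxb hτ => by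
      change M.travelTime b = M.travelTime x + t at hτ
      simp only [mul_sub]
      change _ = ∫ s in x..b, _ * M.rightInvariant p u s (t + M.travelTime x - M.travelTime s) -
        _ * M.rightInvariant p' u' s (t + M.travelTime x - M.travelTime s)
      rw [hs.leftInvariant_eq hK hρ hxb hτ, hs'.leftInvariant_eq hK hρ hxb hτ,
        intervalIntegral.integral_sub
          ((M.scattering hK hρ).intervalIntegrable_reflInside_mul
            (continuousOn_along_left hK hρ hs.continuousOn_rightInvariant hxb hτ))
          ((M.scattering hK hρ).intervalIntegrable_reflInside_mul
            (continuousOn_along_left hK hρ hs'.continuousOn_rightInvariant hxb hτ))]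
      simp only [leftInvariant, (hinit b).1, (hinit b).2]
      ring)
    (fun x t a ht hax hτ => by
      change M.travelTime a = M.travelTime x - t at hτ
      simp only [mul_sub]
      change _ = -∫ s in a..x, _ * M.leftInvariant p u s (t - M.travelTime x + M.travelTime s) -
        _ * M.leftInvariant p' u' s (t - M.travelTime x + M.travelTime s)
      rw [hs.rightInvariant_eq hK hρ hax hτ, hs'.rightInvariant_eq hK hρ hax hτ,
        intervalIntegral.integral_sub
          ((M.scattering hK hρ).intervalIntegrable_reflInside_mul
            (continuousOn_along_right hK hρ hs.continuousOn_leftInvariant hax hτ))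
          ((M.scattering hK hρ).intervalIntegrable_reflInside_mul
            (continuousOn_along_right hK hρ hs'.continuousOn_leftInvariant hax hτ))]
      simp only [rightInvariant, (hinit a).1, (hinit a).2]
      ring) x t ht
  have hG := (M.greenFactor_pos x).ne'
  have hZ := (M.impedance_pos x).ne'
  rw [sub_eq_zero, leftInvariant, leftInvariant, div_left_inj' (by positivity)] at z1
  rw [sub_eq_zero, rightInvariant, rightInvariant, div_left_inj' (by positivity)] at z2
  exact ⟨by linarith, mul_left_cancel₀ hZ (by linarith)⟩

end Solution

end AcousticMedium
end

theorem mainTheorem1 (M : AcousticMedium)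
    (hK : ContDiffOn ℝ 1 M.K (Icc 0 M.xplus))
    (hρ : ContDiffOn ℝ 1 M.ρ (Icc 0 M.xplus))
    (p₀ : ℝ → ℝ) (hp₀ : ContDiff ℝ 1 p₀) (hp₀_supp : ∀ x, 0 ≤ x → p₀ x = 0) :
    (∀ x t : ℝ, 0 ≤ t →
      M.TermsWellDefined p₀ x t ∧
      (Summable fun m => M.wOne p₀ m x t) ∧
      (Summable fun m => M.wTwo p₀ m x t)) ∧
    M.IsSolution p₀ (M.pBar p₀) (M.uBar p₀) ∧
    (∀ p u : ℝ → ℝ → ℝ, M.IsSolution p₀ p u →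
      ∀ x t : ℝ, 0 ≤ t → p x t = M.pBar p₀ x t ∧ u x t = M.uBar p₀ x t) := by
  have hq : Continuous (M.signal p₀) := AcousticMedium.continuous_signal hp₀.continuous
  have hq0 : ∀ t ≤ 0, M.signal p₀ t = 0 :=
    fun t ht => AcousticMedium.signal_of_nonpos hp₀_supp ht
  have hsol := AcousticMedium.isSolution_pBar_uBar hK hρ hp₀ hp₀_supp
  refine ⟨fun x t _ => ⟨AcousticMedium.termsWellDefined hK hρ hp₀.continuous x t, ?_, ?_⟩, hsol,
    fun p u hs x t ht => hs.eq_of_isSolution hK hρ hsol ht⟩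
  · simp_rw [AcousticMedium.wOne_eq hK hρ hp₀.continuous]
    exact ((M.scattering hK hρ).summable_term_odd hq hq0 x t).mul_left _
  · simp_rw [AcousticMedium.wTwo_eq hK hρ hp₀.continuous]
    exact ((M.scattering hK hρ).summable_term_even hq hq0 x t).mul_left _
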